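/- \textbf{Lemma (Control on iterates of the Ornstein--Uhlenbeck generator).} For $\sigma>0$ let $\gamma_{\sigma^2}=\mathcal N(0,\sigma^2 I_n)$ on $\mathbb R^n$, and let $\mathcal L$ be the generator of the scaled Ornstein--Uhlenbeck process with variance $\sigma^2$, acting on smooth functions $f:\mathbb R^n\to\mathbb R^{n'}$ componentwise: $$\mathcal L f(x)=-\frac1{\sigma^2}Df(x)\,x+\Delta f(x).$$ For a measure $\nu$ and a vector-valued $f$, $\|f\|_{L^p(\nu)}=\big(\int\|f\|^p\,d\nu\big)^{1/p}$ with $\|\cdot\|$ the Euclidean norm. A smooth function $f:\mathbb R^n\to\mathbb R^{n'}$ is called \emph{$(r,\sigma)$-Gaussian-noise-sensitive} if for all integers $m\ge 0$ and all real $p\ge1$ $$\|\mathcal L^m f\|_{L^p(\gamma_{\sigma^2})}\le r\sigma\Big(\frac{r m^2}{\sigma^2}\Big)^m\max\{r,\sqrt{mp}\}^m$$ (with the convention $0^0=1$). There is an absolute constant $C>0$ such that the following holds. Let $n\ge 0$, $R\ge\sigma>0$, let $Q_0$ be a probability measure on $\mathbb R^n$ supported on the closed ball $B_R(0)$, let $P=Q_0*\mathcal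 N(0,\sigma^2I_n)$, and let $$f(y)=f_{\sigma^2}(y)=\frac{\int \mu\,\exp\big(\frac{\langle y,\mu\rangle}{\sigma^2}-\frac{\|\mu\|^2}{2\sigma^2}\big)\,dQ_0(\mu)}{\int \exp\big(\frac{\langle y,\mu\rangle}{\sigma^2}-\frac{\|\mu\|^2}{2\sigma^2}\big)\,dQ_0(\mu)},$$ that is, the posterior mean $\mathbb E[\mu\mid Y=y]$ where $\mu\sim Q_0$ and $Y=\mu+\sigma\xi$ with $\xi\sim\mathcal N(0,I_n)$ independent of $\mu$. Then for all integers $m\ge0$ and all real $p\ge1$ (with $0^0=1$) $$\|\mathcal L^m f\|_{L^p(P)}\le R\left(C\,\frac1{\sigma^2}\Big(\frac{mR}{\sigma}\Big)^2\Big(1+\frac{\sqrt{mp}\,\sigma}{R}\Big)\right)^m,$$ $$\|\mathcal L^m f\|_{L^p(\gamma_{\sigma^2})}\le R\left(C\,\frac1{\sigma^2}\,\frac{m^2R}{\sigma}\,\max\Big\{\frac R\sigma,\sqrt{mp}\Big\}\right)^m.$$ Moreover, $f$ is smooth and $(CR/\sigma,\sigma)$-Gaussian-noise-sensitive. -/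

import Mathlib

open MeasureTheory ProbabilityTheory
open scoped ContDiff

/-- The centered Gaussian measure `γ_{σ²} = 𝒩(0, σ² Iₙ)` on `ℝⁿ`: the law of `σ ξ` for a standard
Gaussian vector `ξ`. -/
noncomputable def gaussianVar (n : ℕ) (σ : ℝ) : Measure (EuclideanSpace ℝ (Fin n)) :=
  (stdGaussian (EuclideanSpace ℝ (Fin n))).map (fun x => σ • x)

/-- The generalized Gaussian mixture `Q₀ * 𝒩(0, σ² Iₙ)`: the law of `μ + σ ξ` for independent
`μ ∼ Q₀` and `ξ ∼ 𝒩(0, Iₙ)`. -/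
noncomputable def gaussianMixture {n : ℕ} (Q₀ : Measure (EuclideanSpace ℝ (Fin n))) (σ : ℝ) :
    Measure (EuclideanSpace ℝ (Fin n)) :=
  Q₀.conv (gaussianVar n σ)

/-- The unnormalized posterior weight `exp (⟨y, μ⟩ / σ² - ‖μ‖² / (2 σ²))` of the mean `μ`
(with respect to the prior) given the observation `y = μ + σ ξ`. -/
noncomputable def posteriorWeight {n : ℕ} (σ : ℝ) (y μ : EuclideanSpace ℝ (Fin n)) : ℝ :=
  Real.exp (inner ℝ y μ / σ ^ 2 - ‖μ‖ ^ 2 / (2 * σ ^ 2))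

/-- The posterior mean `f_{σ²}(y) = 𝔼[μ | Y = y]` of `μ ∼ Q₀` given `Y = μ + σ ξ`:
`(∫ μ exp (⟨y, μ⟩ / σ² - ‖μ‖² / (2 σ²)) dQ₀(μ)) / (∫ exp (⟨y, μ⟩ / σ² - ‖μ‖² / (2 σ²)) dQ₀(μ))`. -/
noncomputable def posteriorMean {n : ℕ} (Q₀ : Measure (EuclideanSpace ℝ (Fin n))) (σ : ℝ)
    (y : EuclideanSpace ℝ (Fin n)) : EuclideanSpace ℝ (Fin n) :=
  (∫ μ, posteriorWeight σ y μ ∂Q₀)⁻¹ • ∫ μ, posteriorWeight σ y μ • μ ∂Q₀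

/-- The generator of the scaled Ornstein–Uhlenbeck process with variance `σ²`, acting on
vector-valued functions componentwise: `(ℒ f)(x) = - σ⁻² Df(x) x + Δ f(x)`. -/
noncomputable def ouGenerator {n n' : ℕ} (σ : ℝ)
    (f : EuclideanSpace ℝ (Fin n) → EuclideanSpace ℝ (Fin n')) :
    EuclideanSpace ℝ (Fin n) → EuclideanSpace ℝ (Fin n') :=
  fun x => -((1 / σ ^ 2) • fderiv ℝ f x x) + Laplacian.laplacian f x

/-- A smooth function `f : ℝⁿ → ℝ^{n'}` is `(r, σ)`-Gaussian-noise-sensitive if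
`‖ℒ^m f‖_{L^p(γ_{σ²})} ≤ r σ (r m² / σ²)^m max {r, √(m p)}^m` for all `m ∈ ℕ` and all real `p ≥ 1`.
Smoothness makes all the iterates `ℒ^m f` classically defined. -/
def IsGaussianNoiseSensitive {n n' : ℕ} (r σ : ℝ)
    (f : EuclideanSpace ℝ (Fin n) → EuclideanSpace ℝ (Fin n')) : Prop :=
  ContDiff ℝ ∞ f ∧
    ∀ (m : ℕ) (p : ℝ), 1 ≤ p →
      eLpNorm ((ouGenerator σ)^[m] f) (ENNReal.ofReal p) (gaussianVar n σ) ≤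
        ENNReal.ofReal (r * σ * (r * m ^ 2 / σ ^ 2) ^ m * max r (Real.sqrt (m * p)) ^ m)

/-!
Write `s = 1 / σ²`. The posterior mean `f` is a ratio of two integrals against the weights
`w(y, x) = exp (s ⟪y, x⟫ - s ‖x‖² / 2)`, hence the expectation of the first of several *replicas*
`μ₀, μ₁, …` drawn independently from the posterior distribution given `y` (`replicaMean`).

The algebraic half. For an observable `G(y, μ)` of the first `k` replicas, the derivative of its
posterior expectation in direction `v` is the posterior expectation of
`D_v G + s ⟪v, u_k⟫ G` with `u_k = ∑ i < k, (μ i - μ k)`: the derivative of the weights produces the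
first `k` replicas, and the derivative of the normalization produces a new one
(`fderiv_replicaMean`). Contracting two such derivatives over an orthonormal basis, `ℒ` maps the
posterior expectation of `G` to that of an explicit observable `ouStep G` of two more replicas
(`ouGenerator_replicaMean`). Thus `ℒ^m f` is the posterior expectation of a polynomial of degree at
most `m` in the variables `⟪y, μ_i⟫`, `i ≤ 2 m`. Measuring such polynomials by the sum of the norms
of their coefficients weighted by `M ^ degree` (`PolyBound`), with `M ≥ R² ≥ σ²`, one application
of `ℒ` costs a factor `30 m² s² M` (`PolyBound.ouStep`), without any dependence on the dimension.
This gives a pointwise bound for `ℒ^m f` by `R (30 m² s² M)^m (2 m + 1)` times the posterior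
expectation of `exp (m |⟪y, x⟫| / M)` (`norm_iterate_ouGenerator_posteriorMean_le`).

The analytic half. By Jensen's inequality, applied to the `p`-th power and to the inverse of the
normalization, the `L^p` norm of that expectation reduces to Gaussian exponential moments of
`m p |⟪y, x⟫| / M + s ⟪y, x - z⟫` for `x, z` in the ball. The weights contribute a factor
`exp (O(R² / σ²))`, which is harmless as soon as `m p ≥ R² / σ²`, if `M = √(m p) σ R`
(`lintegral_exp_abs_mul_posteriorWeight_le`). This range of `p` suffices: for smaller `p` the
`L^p` norm is at most the `L^{p'}` norm with `m p' = R² / σ²`, and replacing `p` by `p'` turns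
`√(m p)` into `R / σ`, which is the other term of the maximum in the claim
(`eLpNorm_iterate_le_of_lintegral`). The argument tolerates translating the Gaussian by any vector
of the ball, so it applies to `γ_{σ²}` and to the mixture `Q₀ * γ_{σ²}` alike.
-/

/-! ### Parametric integrals over compact sets, and independence under product measures -/

section ParametricIntegral

lemma integrable_of_continuous_of_ae_mem_compact {Ω F : Type} [TopologicalSpace Ω] [T2Space Ω]
    [MeasurableSpace Ω] [OpensMeasurableSpace Ω] [NormedAddCommGroup F]
    [SecondCountableTopologyEither Ω F] {ρ : Measure Ω} [IsFiniteMeasure ρ] {S : Set Ω}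
    (hS : IsCompact S) (hρ : ∀ᵐ a ∂ρ, a ∈ S)
    {h : Ω → F} (hh : Continuous h) : Integrable h ρ := by
  have := hh.continuousOn.integrableOn_compact (μ := ρ) hS
  rwa [IntegrableOn, Measure.restrict_eq_self_of_ae_mem hρ] at this

variable {X Ω F : Type} [NormedAddCommGroup X] [NormedSpace ℝ X]
  [NormedAddCommGroup Ω] [NormedSpace ℝ Ω] [NormedAddCommGroup F] [NormedSpace ℝ F]

lemma ContDiff.fderiv_left {H : X → Ω → F}
    (hH : ContDiff ℝ ∞ (fun q : X × Ω => H q.1 q.2)) :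
    ContDiff ℝ ∞ (fun q : X × Ω => fderiv ℝ (fun y => H y q.2) q.1) := by
  have h1 : ContDiff ℝ ∞ (Function.uncurry (fun (q : X × Ω) (y : X) => H y q.2)) :=
    hH.comp (contDiff_snd.prodMk (contDiff_snd.comp contDiff_fst))
  exact h1.fderiv contDiff_fst (by simp)

lemma ContDiff.left_section {H : X → Ω → F}
    (hH : ContDiff ℝ ∞ (fun q : X × Ω => H q.1 q.2)) (a : Ω) : ContDiff ℝ ∞ (fun y => H y a) :=
  hH.comp (contDiff_id.prodMk contDiff_const)

lemma ContDiff.continuous_right_section {H : X → Ω → F}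
    (hH : ContDiff ℝ ∞ (fun q : X × Ω => H q.1 q.2)) (y : X) : Continuous (H y) :=
  hH.continuous.comp (continuous_const.prodMk continuous_id)

lemma ContDiff.continuous_fderiv_left {H : X → Ω → F}
    (hH : ContDiff ℝ ∞ (fun q : X × Ω => H q.1 q.2)) (y : X) :
    Continuous (fun a => fderiv ℝ (fun y => H y a) y) :=
  hH.fderiv_left.continuous.comp (continuous_const.prodMk continuous_id)

variable [MeasurableSpace Ω] [BorelSpace Ω] [SecondCountableTopology Ω]
  {ρ : Measure Ω} [IsFiniteMeasure ρ] {S : Set Ω}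

lemma hasFDerivAt_integral_of_ae_mem_compact [FiniteDimensional ℝ X] (hS : IsCompact S)
    (hρ : ∀ᵐ a ∂ρ, a ∈ S)
    {H : X → Ω → F} (hH : ContDiff ℝ ∞ (fun q : X × Ω => H q.1 q.2)) (y : X) :
    HasFDerivAt (fun y => ∫ a, H y a ∂ρ) (∫ a, fderiv ℝ (fun y => H y a) y ∂ρ) y := by
  have hD := hH.fderiv_left
  obtain ⟨B, hB⟩ := ((isCompact_closedBall y 1).prod hS).exists_bound_of_continuousOn
    hD.continuous.continuousOn
  refine hasFDerivAt_integral_of_dominated_of_fderiv_le (bound := fun _ => B)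
    (F' := fun y a => fderiv ℝ (fun y => H y a) y)
    (Metric.closedBall_mem_nhds y one_pos) ?_ ?_ ?_ ?_ (integrable_const _) ?_
  · exact .of_forall fun x =>
      (integrable_of_continuous_of_ae_mem_compact hS hρ
        (hH.continuous_right_section x)).aestronglyMeasurable
  · exact integrable_of_continuous_of_ae_mem_compact hS hρ (hH.continuous_right_section y)
  · exact (integrable_of_continuous_of_ae_mem_compact hS hρ
      (hH.continuous_fderiv_left y)).aestronglyMeasurable
  · filter_upwards [hρ] with a ha x hx using hB (x, a) ⟨hx, ha⟩
  · exact .of_forall fun a x _ =>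
      ((hH.left_section a).differentiable (by simp) x).hasFDerivAt

end ParametricIntegral

/-- Smoothness of a parametric integral; the target space varies along the induction, because the
derivative of the integral is an integral of maps into a space of linear maps. -/
lemma contDiff_integral_of_ae_mem_compact {X Ω : Type} [NormedAddCommGroup X] [NormedSpace ℝ X]
    [FiniteDimensional ℝ X] [NormedAddCommGroup Ω] [NormedSpace ℝ Ω] [MeasurableSpace Ω]
    [BorelSpace Ω] [SecondCountableTopology Ω] {ρ : Measure Ω} [IsFiniteMeasure ρ] {S : Set Ω}
    (hS : IsCompact S) (hρ : ∀ᵐ a ∂ρ, a ∈ S) {F : Type} [NormedAddCommGroup F] [NormedSpace ℝ F]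
    {H : X → Ω → F} (hH : ContDiff ℝ ∞ (fun q : X × Ω => H q.1 q.2)) :
    ContDiff ℝ ∞ (fun y => ∫ a, H y a ∂ρ) := by
  refine contDiff_infty.2 fun N => ?_
  induction N generalizing F with
  | zero =>
    exact contDiff_zero.2 (continuous_iff_continuousAt.2 fun y =>
      (hasFDerivAt_integral_of_ae_mem_compact hS hρ hH y).continuousAt)
  | succ N ih =>
    exact contDiff_succ_iff_hasFDerivAt.2 ⟨_, ih hH.fderiv_left,
      hasFDerivAt_integral_of_ae_mem_compact hS hρ hH⟩

section Product

variable {n N : ℕ} {F : Type} [NormedAddCommGroup F] [NormedSpace ℝ F]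
  (Q : Measure (EuclideanSpace ℝ (Fin n))) [IsProbabilityMeasure Q]

/-- Under a product measure a function of one coordinate is independent of a function of the
others. -/
lemma integral_pi_smul_of_update (i : Fin (N + 1)) (φ : EuclideanSpace ℝ (Fin n) → ℝ)
    {H : (Fin (N + 1) → EuclideanSpace ℝ (Fin n)) → F}
    (hH : ∀ μ x, H (Function.update μ i x) = H μ) :
    ∫ μ, φ (μ i) • H μ ∂Measure.pi (fun _ => Q) =
      (∫ x, φ x ∂Q) • ∫ μ, H μ ∂Measure.pi (fun _ => Q) := by
  have key : ∀ ψ : EuclideanSpace ℝ (Fin n) → ℝ,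
      ∫ μ, ψ (μ i) • H μ ∂Measure.pi (fun _ => Q) =
        (∫ x, ψ x ∂Q) • ∫ z, H (i.insertNth 0 z) ∂Measure.pi (fun _ : Fin N => Q) := by
    intro ψ
    rw [← integral_prod_smul,
      ← ((measurePreserving_piFinSuccAbove (fun _ => Q) i).symm).integral_comp']
    refine integral_congr_ae (.of_forall fun z => ?_)
    have : H (i.insertNth z.1 z.2) = H (i.insertNth 0 z.2) := by
      rw [← hH _ 0, Fin.update_insertNth]
    simpa [MeasurableEquiv.piFinSuccAbove_symm_apply, Fin.insertNthEquiv] using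
      congrArg (ψ z.1 • ·) this
  have h1 := key (fun _ => 1)
  simp only [one_smul, integral_const, probReal_univ] at h1
  rw [key φ, h1]

end Product

/-! ### The Laplacian of products, and weighted coefficient norms of polynomials -/

section Laplacian

variable {E F ι : Type} [NormedAddCommGroup E] [InnerProductSpace ℝ E]
  [NormedAddCommGroup F] [NormedSpace ℝ F]

lemma fderiv_fderiv_apply {g : E → F} (hg : ContDiff ℝ ∞ g) (y v w : E) :
    fderiv ℝ (fun x => fderiv ℝ g x w) y v = fderiv ℝ (fderiv ℝ g) y v w := by
  have h : DifferentiableAt ℝ (fderiv ℝ g) y :=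
    (hg.fderiv_right (m := ∞) (by simp)).differentiable (by simp) y
  rw [fderiv_clm_apply h (by fun_prop)]
  simp

lemma laplacian_eq_sum_fderiv [FiniteDimensional ℝ E] [Fintype ι] (b : OrthonormalBasis ι ℝ E)
    {g : E → F} (hg : ContDiff ℝ ∞ g) (y : E) :
    Laplacian.laplacian g y = ∑ a, fderiv ℝ (fun x => fderiv ℝ g x (b a)) y (b a) := by
  rw [InnerProductSpace.laplacian_eq_iteratedFDeriv_orthonormalBasis g b]
  simp [iteratedFDeriv_two_apply, fderiv_fderiv_apply hg]

lemma fderiv_inner_smul {g : E → F} (hg : ContDiff ℝ ∞ g) (v y w : E) :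
    fderiv ℝ (fun x => inner ℝ x v • g x) y w =
      inner ℝ w v • g y + inner ℝ y v • fderiv ℝ g y w := by
  have h1 : DifferentiableAt ℝ (fun x : E => inner ℝ x v) y :=
    differentiableAt_id.inner ℝ (differentiableAt_const v)
  have h2 : DifferentiableAt ℝ g y := hg.differentiable (by simp) y
  rw [fderiv_fun_smul h1 h2]
  simp [fderiv_inner_apply, add_comm]

lemma laplacian_inner_smul [FiniteDimensional ℝ E] {g : E → F} (hg : ContDiff ℝ ∞ g) (v y : E) :
    Laplacian.laplacian (fun x => inner ℝ x v • g x) y =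
      inner ℝ y v • Laplacian.laplacian g y + (2 : ℝ) • fderiv ℝ g y v := by
  set b := stdOrthonormalBasis ℝ E
  have hD : ∀ w, ContDiff ℝ ∞ (fun x => fderiv ℝ g x w) := fun w =>
    (hg.fderiv_right (m := ∞) (by simp)).clm_apply contDiff_const
  have hg' : ContDiff ℝ ∞ (fun x => inner ℝ x v • g x) :=
    (contDiff_id.inner ℝ contDiff_const).smul hg
  rw [laplacian_eq_sum_fderiv b hg', laplacian_eq_sum_fderiv b hg, Finset.smul_sum]
  have hv : fderiv ℝ g y v = ∑ a, (inner ℝ (b a) v : ℝ) • fderiv ℝ g y (b a) := by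
    conv_lhs => rw [← b.sum_repr' v]
    simp
  rw [hv, Finset.smul_sum, ← Finset.sum_add_distrib]
  refine Finset.sum_congr rfl fun a _ => ?_
  simp_rw [fderiv_inner_smul hg]
  have h1 : DifferentiableAt ℝ (fun x => (inner ℝ (b a) v : ℝ) • g x) y :=
    (hg.differentiable (by simp) y).const_smul _
  have h2 : DifferentiableAt ℝ (fun x => (inner ℝ x v : ℝ) • fderiv ℝ g x (b a)) y :=
    DifferentiableAt.fun_smul (differentiableAt_id.inner ℝ (differentiableAt_const v))
       ((hD _).differentiable (by simp) y)
  rw [fderiv_fun_add h1 h2, add_apply, fderiv_inner_smul (hD _),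
    fderiv_fun_const_smul (hg.differentiable (by simp) y)]
  simp only [smul_apply]
  module

end Laplacian

section PolyBound

variable {E F : Type} [NormedAddCommGroup E] [InnerProductSpace ℝ E]
  [NormedAddCommGroup F] [NormedSpace ℝ F]

/-- `PolyBound V M d c g` says that `g` is a polynomial of degree at most `d`, with coefficients
in `F`, in the linear forms `y ↦ ⟪y, v⟫` for `v ∈ V`, and that it can be written as a sum of
monomials such that the sum of `‖coefficient‖ * M ^ degree` is at most `c`. -/
inductive PolyBound (V : Set E) (M : ℝ) : ℕ → ℝ → (E → F) → Prop
  | const (d : ℕ) (b : F) : PolyBound V M d ‖b‖ (fun _ => b)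
  | add {d : ℕ} {c c' : ℝ} {g g' : E → F} : PolyBound V M d c g → PolyBound V M d c' g' →
      PolyBound V M d (c + c') (fun y => g y + g' y)
  | mul {d : ℕ} {c : ℝ} {g : E → F} {v : E} : v ∈ V → PolyBound V M d c g →
      PolyBound V M (d + 1) (M * c) (fun y => inner ℝ y v • g y)
  | mono {d d' : ℕ} {c c' : ℝ} {g : E → F} : d ≤ d' → c ≤ c' → PolyBound V M d c g →
      PolyBound V M d' c' g

namespace PolyBound

variable {V : Set E} {M R : ℝ} {d : ℕ} {c : ℝ} {g : E → F}

lemma nonneg (hM : 0 ≤ M) (h : PolyBound V M d c g) : 0 ≤ c := by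
  induction h with
  | const d b => positivity
  | add _ _ h1 h2 => positivity
  | mul _ _ ih => positivity
  | mono _ hc _ ih => exact ih.trans hc

lemma contDiff (h : PolyBound V M d c g) : ContDiff ℝ ∞ g := by
  induction h with
  | const d b => exact contDiff_const
  | add _ _ h1 h2 => exact h1.add h2
  | mul _ _ ih => exact (contDiff_id.inner ℝ contDiff_const).smul ih
  | mono _ hc _ ih => exact ih

lemma differentiableAt (h : PolyBound V M d c g) (y : E) : DifferentiableAt ℝ g y :=
  h.contDiff.differentiable (by simp) y

lemma const_smul (t : ℝ) (h : PolyBound V M d c g) :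
    PolyBound V M d (|t| * c) (fun y => t • g y) := by
  induction h with
  | const d b => simpa [norm_smul] using PolyBound.const (V := V) (M := M) d (t • b)
  | add _ _ h1 h2 => simpa [mul_add] using h1.add h2
  | mul hv _ ih => simpa [smul_comm t, mul_left_comm M] using ih.mul hv
  | mono hd hc _ ih => exact ih.mono hd (by gcongr)

lemma zero (d : ℕ) : PolyBound V M d 0 (fun _ => (0 : F)) := by
  simpa using PolyBound.const (V := V) (M := M) d (0 : F)

lemma sum {α : Type} (s : Finset α) {c : α → ℝ} {g : α → E → F}
    (h : ∀ i ∈ s, PolyBound V M d (c i) (g i)) :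
    PolyBound V M d (∑ i ∈ s, c i) (fun y => ∑ i ∈ s, g i y) := by
  classical
  induction s using Finset.induction_on with
  | empty => simpa using zero d
  | insert a s ha ih =>
    simp_rw [Finset.sum_insert ha]
    exact (h a (by simp)).add (ih fun i hi => h i (by simp [hi]))

/-- Differentiating a monomial `y ↦ ∏ ⟪y, v_l⟫` in direction `u` replaces one of its at most `d`
factors by some `⟪u, v_l⟫`. The degree bound is kept rather than lowered by one. -/
lemma fderiv_apply (hM : 0 < M) (hR : 0 ≤ R) (hV : ∀ v ∈ V, ‖v‖ ≤ R)
    (h : PolyBound V M d c g) (u : E) :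
    PolyBound V M d (d * (‖u‖ * R / M) * c) (fun y => fderiv ℝ g y u) := by
  induction h with
  | const d b =>
    simp only [fderiv_fun_const, Pi.zero_apply, zero_apply]
    exact (zero d).mono le_rfl (by positivity)
  | @add d c c' g g' hg hg' h1 h2 =>
    have : (fun y => fderiv ℝ (fun y => g y + g' y) y u) =
        fun y => fderiv ℝ g y u + fderiv ℝ g' y u := by
      ext y
      rw [fderiv_fun_add (hg.differentiableAt y) (hg'.differentiableAt y)]
      rfl
    rw [this]
    exact (h1.add h2).mono le_rfl (by rw [mul_add])
  | @mul d c g v hv hg ih =>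
    simp_rw [fderiv_inner_smul hg.contDiff]
    refine (((hg.mono (Nat.le_succ d) le_rfl).const_smul _).add (ih.mul hv)).mono le_rfl ?_
    have hc := hg.nonneg hM.le
    have : |inner ℝ u v| ≤ ‖u‖ * R :=
      (abs_real_inner_le_norm u v).trans (by gcongr; exact hV v hv)
    calc |inner ℝ u v| * c + M * (d * (‖u‖ * R / M) * c)
        ≤ ‖u‖ * R * c + M * (d * (‖u‖ * R / M) * c) := by gcongr
      _ = _ := by push_cast; field_simp; ring
  | @mono d d' c c' g hd hc hg ih =>
    have hc0 := hg.nonneg hM.le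
    exact ih.mono hd (by gcongr)

/-- The Euler operator `y ↦ D g(y) y` multiplies every monomial by its degree. -/
lemma fderiv_self (hM : 0 ≤ M) (h : PolyBound V M d c g) :
    PolyBound V M d (d * c) (fun y => fderiv ℝ g y y) := by
  induction h with
  | const d b =>
    simp only [fderiv_fun_const, Pi.zero_apply, zero_apply]
    exact (zero d).mono le_rfl (by positivity)
  | @add d c c' g g' hg hg' h1 h2 =>
    have : (fun y => fderiv ℝ (fun y => g y + g' y) y y) =
        fun y => fderiv ℝ g y y + fderiv ℝ g' y y := by
      ext y
      rw [fderiv_fun_add (hg.differentiableAt y) (hg'.differentiableAt y)]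
      rfl
    rw [this]
    exact (h1.add h2).mono le_rfl (by rw [mul_add])
  | @mul d c g v hv hg ih =>
    simp_rw [fderiv_inner_smul hg.contDiff]
    exact ((hg.mul hv).add (ih.mul hv)).mono le_rfl (by push_cast; linarith)
  | @mono d d' c c' g hd hc hg ih =>
    have hc0 := hg.nonneg hM
    exact ih.mono hd (by gcongr)

/-- The Laplacian replaces two factors of a monomial by the inner product of their vectors; the
bound does not depend on the dimension. -/
lemma laplacian [FiniteDimensional ℝ E] (hM : 0 < M) (hR : 0 ≤ R) (hV : ∀ v ∈ V, ‖v‖ ≤ R)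
    (h : PolyBound V M d c g) :
    PolyBound V M d ((d * R / M) ^ 2 * c) (fun y => Laplacian.laplacian g y) := by
  induction h with
  | const d b =>
    have : (fun y => Laplacian.laplacian (fun _ : E => b) y) = fun _ => (0 : F) := by
      ext y
      simp [InnerProductSpace.laplacian_eq_iteratedFDeriv_stdOrthonormalBasis,
        iteratedFDeriv_two_apply]
    rw [this]
    exact (zero d).mono le_rfl (by positivity)
  | @add d c c' g g' hg hg' h1 h2 =>
    have : (fun y => Laplacian.laplacian (fun y => g y + g' y) y) =
        fun y => Laplacian.laplacian g y + Laplacian.laplacian g' y := by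
      ext y
      have h2 : (2 : WithTop ℕ∞) ≤ ∞ := WithTop.coe_le_coe.2 (le_top : (2 : ℕ∞) ≤ ⊤)
      exact ContDiffAt.laplacian_add (hg.contDiff.of_le h2).contDiffAt
        (hg'.contDiff.of_le h2).contDiffAt
    rw [this]
    exact (h1.add h2).mono le_rfl (by rw [mul_add])
  | @mul d c g v hv hg ih =>
    simp_rw [laplacian_inner_smul hg.contDiff]
    refine ((ih.mul hv).add (((hg.fderiv_apply hM hR hV v).const_smul 2).mono
      (Nat.le_succ d) le_rfl)).mono le_rfl ?_
    have hc := hg.nonneg hM.le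
    have hvR := hV v hv
    calc M * ((d * R / M) ^ 2 * c) + |2| * (d * (‖v‖ * R / M) * c)
        ≤ M * ((d * R / M) ^ 2 * c) + |2| * (d * (R * R / M) * c) := by gcongr
      _ ≤ M * ((d * R / M) ^ 2 * c) + |2| * (d * (R * R / M) * c) + R * R / M * c := by
        have : 0 ≤ R * R / M * c := by positivity
        linarith
      _ = _ := by rw [abs_two]; push_cast; field_simp; ring
  | @mono d d' c c' g hd hc hg ih =>
    have hc0 := hg.nonneg hM.le
    exact ih.mono hd (by gcongr)

/-- A `PolyBound` controls the values wherever the linear forms from `V` are at most `M * X`. -/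
lemma norm_le (hM : 0 < M) (h : PolyBound V M d c g) {y : E} {X : ℝ} (hX : 0 ≤ X)
    (hy : ∀ v ∈ V, |inner ℝ y v| ≤ M * X) : ‖g y‖ ≤ c * (1 + X) ^ d := by
  induction h with
  | const d b => exact le_mul_of_one_le_right (norm_nonneg b) (one_le_pow₀ (by linarith))
  | add _ _ h1 h2 => exact (norm_add_le _ _).trans (by rw [add_mul]; gcongr)
  | @mul d c g v hv hg ih =>
    have hc := hg.nonneg hM.le
    rw [norm_smul, Real.norm_eq_abs, pow_succ']
    calc |inner ℝ y v| * ‖g y‖ ≤ (M * X) * (c * (1 + X) ^ d) := by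
          gcongr
          exact hy v hv
      _ ≤ (M * (1 + X)) * (c * (1 + X) ^ d) := by gcongr; linarith
      _ = _ := by ring
  | @mono d d' c c' g hd hc hg ih =>
    have hc0 := hg.nonneg hM.le
    exact ih.trans (mul_le_mul hc (pow_le_pow_right₀ (by linarith) hd) (by positivity)
      (hc0.trans hc))

end PolyBound

end PolyBound

/-! ### Posterior expectations of observables of replicas -/

/-- The unnormalized posterior weight of a family `μ` of independent replicas of the mean. -/
noncomputable def replicaWeight {n N : ℕ} (σ : ℝ) (y : EuclideanSpace ℝ (Fin n))
    (μ : Fin N → EuclideanSpace ℝ (Fin n)) : ℝ :=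
  ∏ i, posteriorWeight σ y (μ i)

/-- The posterior expectation at `y` of an observable `G y μ`, where `μ` is a family of `N`
replicas drawn independently from the posterior distribution given `y`. -/
noncomputable def replicaMean {n N : ℕ} {F : Type} [NormedAddCommGroup F] [NormedSpace ℝ F]
    (Q : Measure (EuclideanSpace ℝ (Fin n))) (σ : ℝ)
    (G : EuclideanSpace ℝ (Fin n) → (Fin N → EuclideanSpace ℝ (Fin n)) → F)
    (y : EuclideanSpace ℝ (Fin n)) : F :=
  (∫ μ, replicaWeight σ y μ ∂Measure.pi (fun _ : Fin N => Q))⁻¹ •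
    ∫ μ, replicaWeight σ y μ • G y μ ∂Measure.pi (fun _ : Fin N => Q)

/-- `∑ i < k, (μ i - μ k)`: the sum of the first `k` replicas, centred by means of the replica
with index `k`. -/
noncomputable def centredSum {n N : ℕ} (k : Fin N) (μ : Fin N → EuclideanSpace ℝ (Fin n)) :
    EuclideanSpace ℝ (Fin n) :=
  ∑ i ∈ Finset.Iio k, (μ i - μ k)

section Weight

variable {n N : ℕ} {σ : ℝ}

lemma posteriorWeight_pos (y x : EuclideanSpace ℝ (Fin n)) : 0 < posteriorWeight σ y x :=
  Real.exp_pos _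

lemma replicaWeight_pos (y : EuclideanSpace ℝ (Fin n)) (μ : Fin N → EuclideanSpace ℝ (Fin n)) :
    0 < replicaWeight σ y μ :=
  Finset.prod_pos fun _ _ => posteriorWeight_pos _ _

lemma contDiff_posteriorWeight :
    ContDiff ℝ ∞ (fun q : EuclideanSpace ℝ (Fin n) × EuclideanSpace ℝ (Fin n) =>
      posteriorWeight σ q.1 q.2) := by
  unfold posteriorWeight
  exact Real.contDiff_exp.comp (((contDiff_fst.inner ℝ contDiff_snd).div_const _).sub
    ((contDiff_snd.norm_sq ℝ).div_const _))

lemma contDiff_replicaWeight :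
    ContDiff ℝ ∞ (fun q : EuclideanSpace ℝ (Fin n) × (Fin N → EuclideanSpace ℝ (Fin n)) =>
      replicaWeight σ q.1 q.2) :=
  contDiff_prod fun i _ => contDiff_posteriorWeight.comp
    (contDiff_fst.prodMk ((contDiff_apply ℝ _ i).comp contDiff_snd))

lemma fderiv_posteriorWeight (y x v : EuclideanSpace ℝ (Fin n)) :
    fderiv ℝ (fun y => posteriorWeight σ y x) y v =
      posteriorWeight σ y x * (1 / σ ^ 2 * inner ℝ v x) := by
  unfold posteriorWeight
  have h : HasFDerivAt (fun y : EuclideanSpace ℝ (Fin n) =>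
      inner ℝ y x / σ ^ 2 - ‖x‖ ^ 2 / (2 * σ ^ 2)) ((1 / σ ^ 2) • innerSL ℝ x) y := by
    have h1 : HasFDerivAt (fun y : EuclideanSpace ℝ (Fin n) => (1 / σ ^ 2) * inner ℝ x y)
      ((1 / σ ^ 2) • innerSL ℝ x) y := (innerSL ℝ x).hasFDerivAt.const_mul _
    convert! h1.sub_const (‖x‖ ^ 2 / (2 * σ ^ 2)) using 2
    rw [real_inner_comm]
    ring
  rw [h.exp.fderiv]
  simp [real_inner_comm]

lemma fderiv_replicaWeight (y v : EuclideanSpace ℝ (Fin n))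
    (μ : Fin N → EuclideanSpace ℝ (Fin n)) :
    fderiv ℝ (fun y => replicaWeight σ y μ) y v =
      replicaWeight σ y μ * (1 / σ ^ 2 * ∑ i, inner ℝ v (μ i)) := by
  unfold replicaWeight
  rw [fderiv_finsetProd (fun i _ => (contDiff_posteriorWeight.left_section
    (μ i)).differentiable (by simp) y)]
  simp only [_root_.sum_apply, _root_.smul_apply, fderiv_posteriorWeight,
    smul_eq_mul, Finset.mul_sum]
  refine Finset.sum_congr rfl fun i hi => ?_
  rw [← Finset.prod_erase_mul _ _ hi]
  ring

end Weight

section Mean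

variable {n N : ℕ} {σ R : ℝ} {F : Type} [NormedAddCommGroup F] [NormedSpace ℝ F]
  {Q : Measure (EuclideanSpace ℝ (Fin n))}

lemma replicaMean_const_smul (c : ℝ)
    (G : EuclideanSpace ℝ (Fin n) → (Fin N → EuclideanSpace ℝ (Fin n)) → F)
    (y : EuclideanSpace ℝ (Fin n)) :
    replicaMean Q σ (fun y μ => c • G y μ) y = c • replicaMean Q σ G y := by
  simp only [replicaMean, smul_comm _ c, integral_smul]

variable [IsProbabilityMeasure Q]

lemma ae_pi_mem_closedBall (hQ : ∀ᵐ x ∂Q, x ∈ Metric.closedBall 0 R) :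
    ∀ᵐ μ ∂Measure.pi (fun _ : Fin N => Q),
      μ ∈ Set.univ.pi (fun _ : Fin N => Metric.closedBall (0 : EuclideanSpace ℝ (Fin n)) R) := by
  simp only [Set.mem_univ_pi]
  exact ae_all_iff.2 fun i =>
    (measurePreserving_eval (fun _ : Fin N => Q) i).quasiMeasurePreserving.ae hQ

lemma isCompact_pi_closedBall :
    IsCompact (Set.univ.pi
      (fun _ : Fin N => Metric.closedBall (0 : EuclideanSpace ℝ (Fin n)) R)) :=
  isCompact_univ_pi fun _ => isCompact_closedBall _ _

lemma integrable_pi_of_continuous {F : Type} [NormedAddCommGroup F]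
    (hQ : ∀ᵐ x ∂Q, x ∈ Metric.closedBall 0 R)
    {h : (Fin N → EuclideanSpace ℝ (Fin n)) → F} (hh : Continuous h) :
    Integrable h (Measure.pi (fun _ : Fin N => Q)) :=
  integrable_of_continuous_of_ae_mem_compact isCompact_pi_closedBall (ae_pi_mem_closedBall hQ) hh

lemma continuous_replicaWeight (y : EuclideanSpace ℝ (Fin n)) :
    Continuous (fun μ : Fin N → EuclideanSpace ℝ (Fin n) => replicaWeight σ y μ) :=
  contDiff_replicaWeight.continuous_right_section y

lemma integrable_replicaWeight_smul (hQ : ∀ᵐ x ∂Q, x ∈ Metric.closedBall 0 R)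
    (y : EuclideanSpace ℝ (Fin n)) {h : (Fin N → EuclideanSpace ℝ (Fin n)) → F}
    (hh : Continuous h) :
    Integrable (fun μ => replicaWeight σ y μ • h μ) (Measure.pi (fun _ : Fin N => Q)) :=
  integrable_pi_of_continuous hQ ((continuous_replicaWeight y).smul hh)

lemma integral_replicaWeight_pos (hQ : ∀ᵐ x ∂Q, x ∈ Metric.closedBall 0 R)
    (y : EuclideanSpace ℝ (Fin n)) :
    0 < ∫ μ, replicaWeight σ y μ ∂Measure.pi (fun _ : Fin N => Q) := by
  have h := integrable_pi_of_continuous (N := N) hQ (continuous_replicaWeight (σ := σ) y)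
  rw [integral_pos_iff_support_of_nonneg (fun μ => (replicaWeight_pos y μ).le) h]
  have : Function.support (fun μ : Fin N → EuclideanSpace ℝ (Fin n) => replicaWeight σ y μ) =
      Set.univ := by
    ext μ
    simp [(replicaWeight_pos y μ).ne']
  rw [this]
  simp

lemma replicaMean_add (hQ : ∀ᵐ x ∂Q, x ∈ Metric.closedBall 0 R)
    {G H : EuclideanSpace ℝ (Fin n) → (Fin N → EuclideanSpace ℝ (Fin n)) → F}
    {y : EuclideanSpace ℝ (Fin n)} (hG : Continuous (G y)) (hH : Continuous (H y)) :
    replicaMean Q σ (fun y μ => G y μ + H y μ) y =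
      replicaMean Q σ G y + replicaMean Q σ H y := by
  simp only [replicaMean, smul_add]
  rw [integral_add (integrable_replicaWeight_smul hQ y hG) (integrable_replicaWeight_smul hQ y hH),
    smul_add]

lemma replicaMean_sub (hQ : ∀ᵐ x ∂Q, x ∈ Metric.closedBall 0 R)
    {G H : EuclideanSpace ℝ (Fin n) → (Fin N → EuclideanSpace ℝ (Fin n)) → F}
    {y : EuclideanSpace ℝ (Fin n)} (hG : Continuous (G y)) (hH : Continuous (H y)) :
    replicaMean Q σ (fun y μ => G y μ - H y μ) y =
      replicaMean Q σ G y - replicaMean Q σ H y := by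
  simp only [replicaMean, smul_sub]
  rw [integral_sub (integrable_replicaWeight_smul hQ y hG) (integrable_replicaWeight_smul hQ y hH),
    smul_sub]

lemma replicaMean_sum (hQ : ∀ᵐ x ∂Q, x ∈ Metric.closedBall 0 R) {α : Type} (s : Finset α)
    {G : α → EuclideanSpace ℝ (Fin n) → (Fin N → EuclideanSpace ℝ (Fin n)) → F}
    {y : EuclideanSpace ℝ (Fin n)} (hG : ∀ i ∈ s, Continuous (G i y)) :
    replicaMean Q σ (fun y μ => ∑ i ∈ s, G i y μ) y = ∑ i ∈ s, replicaMean Q σ (G i) y := by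
  simp only [replicaMean, Finset.smul_sum]
  rw [integral_finsetSum _ fun i hi => integrable_replicaWeight_smul hQ y (hG i hi),
    Finset.smul_sum]

lemma contDiff_integral_replicaWeight_smul (hQ : ∀ᵐ x ∂Q, x ∈ Metric.closedBall 0 R)
    {G : EuclideanSpace ℝ (Fin n) → (Fin N → EuclideanSpace ℝ (Fin n)) → F}
    (hG : ContDiff ℝ ∞ (fun q : EuclideanSpace ℝ (Fin n) × (Fin N → EuclideanSpace ℝ (Fin n)) =>
      G q.1 q.2)) :
    ContDiff ℝ ∞ (fun y => ∫ μ, replicaWeight σ y μ • G y μ ∂Measure.pi (fun _ : Fin N => Q)) :=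
  contDiff_integral_of_ae_mem_compact isCompact_pi_closedBall (ae_pi_mem_closedBall hQ)
    (contDiff_replicaWeight.smul hG)

lemma contDiff_integral_replicaWeight (hQ : ∀ᵐ x ∂Q, x ∈ Metric.closedBall 0 R) :
    ContDiff ℝ ∞ (fun y => ∫ μ, replicaWeight σ y μ ∂Measure.pi (fun _ : Fin N => Q)) :=
  contDiff_integral_of_ae_mem_compact isCompact_pi_closedBall (ae_pi_mem_closedBall hQ)
    contDiff_replicaWeight

lemma contDiff_replicaMean (hQ : ∀ᵐ x ∂Q, x ∈ Metric.closedBall 0 R)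
    {G : EuclideanSpace ℝ (Fin n) → (Fin N → EuclideanSpace ℝ (Fin n)) → F}
    (hG : ContDiff ℝ ∞ (fun q : EuclideanSpace ℝ (Fin n) × (Fin N → EuclideanSpace ℝ (Fin n)) =>
      G q.1 q.2)) :
    ContDiff ℝ ∞ (replicaMean Q σ G) :=
  ((contDiff_integral_replicaWeight hQ).inv fun y => (integral_replicaWeight_pos hQ y).ne').smul
    (contDiff_integral_replicaWeight_smul hQ hG)

lemma fderiv_integral_replicaWeight_smul (hQ : ∀ᵐ x ∂Q, x ∈ Metric.closedBall 0 R)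
    [CompleteSpace F]
    {G : EuclideanSpace ℝ (Fin n) → (Fin N → EuclideanSpace ℝ (Fin n)) → F}
    (hG : ContDiff ℝ ∞ (fun q : EuclideanSpace ℝ (Fin n) × (Fin N → EuclideanSpace ℝ (Fin n)) =>
      G q.1 q.2)) (y v : EuclideanSpace ℝ (Fin n)) :
    fderiv ℝ (fun y => ∫ μ, replicaWeight σ y μ • G y μ ∂Measure.pi (fun _ : Fin N => Q)) y v =
      ∫ μ, replicaWeight σ y μ • (fderiv ℝ (fun y => G y μ) y v +
        (1 / σ ^ 2 * ∑ i, inner ℝ v (μ i)) • G y μ) ∂Measure.pi (fun _ : Fin N => Q) := by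
  have hWG := contDiff_replicaWeight (σ := σ).smul hG
  have hWG' := fun y => ContDiff.continuous_fderiv_left
    (H := fun y μ => replicaWeight σ y μ • G y μ) hWG y
  rw [(hasFDerivAt_integral_of_ae_mem_compact isCompact_pi_closedBall (ae_pi_mem_closedBall hQ)
    hWG y).fderiv, ContinuousLinearMap.integral_apply]
  · refine integral_congr_ae (.of_forall fun μ => ?_)
    simp only
    rw [fderiv_fun_smul ((contDiff_replicaWeight.left_section μ).differentiable (by simp) y)
      ((hG.left_section μ).differentiable (by simp) y)]
    simp only [_root_.add_apply, _root_.smul_apply, ContinuousLinearMap.smulRight_apply,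
      fderiv_replicaWeight, smul_add, smul_smul]
  · exact integrable_pi_of_continuous hQ (hWG' y)

end Mean

/-! ### Derivatives of posterior expectations -/

lemma fderiv_inv_smul {X F : Type} [NormedAddCommGroup X] [NormedSpace ℝ X]
    [NormedAddCommGroup F] [NormedSpace ℝ F] {Z : X → ℝ} {A : X → F} {y : X}
    (hZ : DifferentiableAt ℝ Z y) (hA : DifferentiableAt ℝ A y) (h0 : Z y ≠ 0) (v : X) :
    fderiv ℝ (fun y => (Z y)⁻¹ • A y) y v =
      (Z y)⁻¹ • fderiv ℝ A y v - ((Z y)⁻¹ * fderiv ℝ Z y v) • ((Z y)⁻¹ • A y) := by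
  have hinv : HasFDerivAt (fun y => (Z y)⁻¹) (-(Z y ^ 2)⁻¹ • fderiv ℝ Z y) y :=
    (hasDerivAt_inv h0).comp_hasFDerivAt y hZ.hasFDerivAt
  rw [(hinv.fun_smul hA.hasFDerivAt).fderiv]
  simp only [_root_.add_apply, _root_.smul_apply, ContinuousLinearMap.smulRight_apply, smul_smul,
    sub_eq_add_neg, ← neg_smul, smul_eq_mul]
  congr 2
  field_simp

section Replicas

variable {n N : ℕ} {σ R : ℝ} {F : Type} [NormedAddCommGroup F] [NormedSpace ℝ F]
  {Q : Measure (EuclideanSpace ℝ (Fin n))} [IsProbabilityMeasure Q]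

/-- The posterior replicas are independent: a replica on which the observable does not depend can
be averaged separately. -/
lemma replicaMean_smul_of_update (hQ : ∀ᵐ x ∂Q, x ∈ Metric.closedBall 0 R)
    (φ : EuclideanSpace ℝ (Fin n) → EuclideanSpace ℝ (Fin n) → ℝ)
    {G : EuclideanSpace ℝ (Fin n) → (Fin (N + 1) → EuclideanSpace ℝ (Fin n)) → F}
    {i : Fin (N + 1)} (y : EuclideanSpace ℝ (Fin n))
    (hG : ∀ μ x, G y (Function.update μ i x) = G y μ) :
    replicaMean Q σ (fun y μ => φ y (μ i) • G y μ) y =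
      ((∫ x, posteriorWeight σ y x ∂Q)⁻¹ * ∫ x, posteriorWeight σ y x * φ y x ∂Q) •
        replicaMean Q σ G y := by
  have hW : ∀ μ : Fin (N + 1) → EuclideanSpace ℝ (Fin n), replicaWeight σ y μ =
      posteriorWeight σ y (μ i) * ∏ j ∈ Finset.univ.erase i, posteriorWeight σ y (μ j) :=
    fun μ => (Finset.mul_prod_erase _ _ (Finset.mem_univ i)).symm
  have hX : ∀ (μ : Fin (N + 1) → EuclideanSpace ℝ (Fin n)) x,
      ∏ j ∈ Finset.univ.erase i, posteriorWeight σ y (Function.update μ i x j) =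
        ∏ j ∈ Finset.univ.erase i, posteriorWeight σ y (μ j) := fun μ x =>
    Finset.prod_congr rfl fun j hj => by rw [Function.update_of_ne (Finset.ne_of_mem_erase hj)]
  have h1 := integral_pi_smul_of_update Q i (fun x => posteriorWeight σ y x * φ y x)
    (H := fun μ => (∏ j ∈ Finset.univ.erase i, posteriorWeight σ y (μ j)) • G y μ)
    (fun μ x => by rw [hX, hG])
  have h2 := integral_pi_smul_of_update Q i (fun x => posteriorWeight σ y x)
    (H := fun μ => (∏ j ∈ Finset.univ.erase i, posteriorWeight σ y (μ j)) • G y μ)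
    (fun μ x => by rw [hX, hG])
  have h3 := integral_pi_smul_of_update Q i (fun x => posteriorWeight σ y x)
    (H := fun μ => ∏ j ∈ Finset.univ.erase i, posteriorWeight σ y (μ j)) hX
  have hpos := integral_replicaWeight_pos (N := N + 1) (σ := σ) hQ y
  simp only [smul_eq_mul] at h3
  simp only [replicaMean, hW, smul_smul] at h1 h2 h3 hpos ⊢
  simp only [mul_right_comm _ _ (φ y _), h1, h2]
  rw [smul_smul, smul_smul]
  congr 1
  rw [h3] at hpos ⊢
  have := left_ne_zero_of_mul hpos.ne'
  have := right_ne_zero_of_mul hpos.ne'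
  field_simp

/-- The derivative of a posterior expectation is a posterior expectation: for an observable of the
first `k` replicas, one further replica accounts for the derivative of the normalization. -/
lemma fderiv_replicaMean [CompleteSpace F] (hQ : ∀ᵐ x ∂Q, x ∈ Metric.closedBall 0 R)
    {G : EuclideanSpace ℝ (Fin n) → (Fin (N + 1) → EuclideanSpace ℝ (Fin n)) → F}
    (hG : ContDiff ℝ ∞
      (fun q : EuclideanSpace ℝ (Fin n) × (Fin (N + 1) → EuclideanSpace ℝ (Fin n)) => G q.1 q.2))
    {k : Fin (N + 1)} (hk : ∀ y μ i x, k ≤ i → G y (Function.update μ i x) = G y μ)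
    (y v : EuclideanSpace ℝ (Fin n)) :
    fderiv ℝ (replicaMean Q σ G) y v = replicaMean Q σ (fun y μ =>
      fderiv ℝ (fun y => G y μ) y v + (1 / σ ^ 2 * inner ℝ v (centredSum k μ)) • G y μ) y := by
  have hpos := integral_replicaWeight_pos (N := N + 1) (σ := σ) hQ y
  have hGy := hG.continuous_right_section
  have hDy : Continuous fun μ => fderiv ℝ (fun y => G y μ) y v :=
    (hG.continuous_fderiv_left y).clm_apply continuous_const
  set e : ℝ := (∫ x, posteriorWeight σ y x ∂Q)⁻¹ * ∫ x, posteriorWeight σ y x * inner ℝ v x ∂Q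
  -- replicas on which `G` does not depend contribute the mean `e`
  have hi : ∀ i, k ≤ i → replicaMean Q σ (fun y μ => (inner ℝ v (μ i) : ℝ) • G y μ) y =
      e • replicaMean Q σ G y := fun i hi =>
    replicaMean_smul_of_update hQ (fun _ x => inner ℝ v x) y fun μ x => hk y μ i x hi
  have hone : ∀ i : Fin (N + 1), replicaMean Q σ
      (fun _ (μ : Fin (N + 1) → EuclideanSpace ℝ (Fin n)) => (inner ℝ v (μ i) : ℝ)) y = e := by
    intro i
    have h := replicaMean_smul_of_update (F := ℝ) (N := N) (i := i) (σ := σ) hQ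
      (fun _ x => inner ℝ v x) (G := fun _ _ => 1) y fun _ _ => rfl
    simp only [smul_eq_mul, mul_one] at h
    rw [h]
    simp only [replicaMean, smul_eq_mul, mul_one]
    rw [inv_mul_cancel₀ hpos.ne', mul_one]
  have hc : ∀ w, Continuous fun μ : Fin (N + 1) → EuclideanSpace ℝ (Fin n) =>
      (inner ℝ v (μ w) : ℝ) := fun w => continuous_const.inner (continuous_apply w)
  -- the quotient rule
  have hquot : fderiv ℝ (replicaMean Q σ G) y v =
      replicaMean Q σ (fun y μ => fderiv ℝ (fun y => G y μ) y v +
        (1 / σ ^ 2 * ∑ i, inner ℝ v (μ i)) • G y μ) y -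
      replicaMean Q σ (fun _ (μ : Fin (N + 1) → EuclideanSpace ℝ (Fin n)) =>
        1 / σ ^ 2 * ∑ i, inner ℝ v (μ i)) y • replicaMean Q σ G y := by
    have hZ := fderiv_integral_replicaWeight_smul (σ := σ) hQ (F := ℝ) (N := N + 1)
      (G := fun _ _ => 1) contDiff_const y v
    simp only [smul_eq_mul, mul_one, fderiv_fun_const, Pi.zero_apply, zero_apply, zero_add] at hZ
    have hA := fderiv_integral_replicaWeight_smul (σ := σ) hQ hG y v
    have dZ := (contDiff_integral_replicaWeight (N := N + 1) (σ := σ) hQ).differentiable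
      (by simp) y
    have dA := (contDiff_integral_replicaWeight_smul (σ := σ) hQ hG).differentiable (by simp) y
    have : replicaMean Q σ G = fun y =>
      (∫ μ, replicaWeight σ y μ ∂Measure.pi (fun _ : Fin (N + 1) => Q))⁻¹ •
        ∫ μ, replicaWeight σ y μ • G y μ ∂Measure.pi (fun _ : Fin (N + 1) => Q) := rfl
    rw [this, fderiv_inv_smul dZ dA hpos.ne', hA, hZ]
    simp only [replicaMean, smul_eq_mul]
  rw [hquot, replicaMean_add hQ hDy (by fun_prop), replicaMean_add hQ hDy
    (by unfold centredSum; fun_prop), add_sub_assoc]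
  congr 1
  have h1 : replicaMean Q σ (fun _ (μ : Fin (N + 1) → EuclideanSpace ℝ (Fin n)) =>
        1 / σ ^ 2 * ∑ i, inner ℝ v (μ i)) y =
      1 / σ ^ 2 * ((N + 1 : ℕ) * e) := by
    have := replicaMean_const_smul (Q := Q) (σ := σ) (1 / σ ^ 2)
      (fun _ (μ : Fin (N + 1) → _) => ∑ i, (inner ℝ v (μ i) : ℝ)) y
    simp only [smul_eq_mul] at this
    rw [this, replicaMean_sum hQ _ fun i _ => hc i, Finset.sum_congr rfl fun i _ => hone i]
    simp
  have h2 : replicaMean Q σ (fun y μ => (1 / σ ^ 2 * ∑ i, inner ℝ v (μ i)) • G y μ) y =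
      (1 / σ ^ 2) • ∑ i, replicaMean Q σ (fun y μ => (inner ℝ v (μ i) : ℝ) • G y μ) y := by
    simp only [mul_smul, Finset.sum_smul]
    rw [replicaMean_const_smul, replicaMean_sum hQ _ fun i _ => (hc i).smul (hGy y)]
  have h3 : replicaMean Q σ (fun y μ => (1 / σ ^ 2 * inner ℝ v (centredSum k μ)) • G y μ) y =
      (1 / σ ^ 2) • ∑ i ∈ Finset.Iio k,
        (replicaMean Q σ (fun y μ => (inner ℝ v (μ i) : ℝ) • G y μ) y -
          e • replicaMean Q σ G y) := by
    simp only [mul_smul, centredSum, inner_sum, Finset.sum_smul]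
    rw [replicaMean_const_smul, replicaMean_sum hQ _ fun i _ =>
      ((continuous_const.inner ((continuous_apply i).sub (continuous_apply k))).smul (hGy y))]
    congr 1
    refine Finset.sum_congr rfl fun i _ => ?_
    simp only [inner_sub_right, sub_smul]
    rw [replicaMean_sub hQ ((hc i).smul (hGy y)) ((hc k).smul (hGy y)), hi k le_rfl]
  rw [h1, h2, h3, ← Finset.sum_add_sum_compl (Finset.Iio k),
    Finset.sum_congr rfl fun i (hi' : i ∈ (Finset.Iio k)ᶜ) => hi i (by simpa using hi')]
  simp only [Finset.sum_sub_distrib, Finset.sum_const, Finset.card_compl, Fin.card_Iio,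
    Fintype.card_fin, ← Nat.cast_smul_eq_nsmul ℝ, Nat.cast_sub k.2.le]
  module

end Replicas

/-! ### The generator acting on observables -/

/-- The observable whose posterior expectation is `ℒ` applied to the posterior expectation of `G`,
if `G` depends only on the replicas with index less than `k` and `k'` is the successor of `k`. -/
noncomputable def ouStep {n n' N : ℕ} (σ : ℝ) (k k' : Fin N)
    (G : EuclideanSpace ℝ (Fin n) → (Fin N → EuclideanSpace ℝ (Fin n)) →
      EuclideanSpace ℝ (Fin n'))
    (y : EuclideanSpace ℝ (Fin n)) (μ : Fin N → EuclideanSpace ℝ (Fin n)) :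
    EuclideanSpace ℝ (Fin n') :=
  Laplacian.laplacian (fun y => G y μ) y +
    (1 / σ ^ 2) • fderiv ℝ (fun y => G y μ) y (centredSum k μ + centredSum k' μ) +
    ((1 / σ ^ 2) ^ 2 * inner ℝ (centredSum k μ) (centredSum k' μ)) • G y μ +
    (-(1 / σ ^ 2)) • fderiv ℝ (fun y => G y μ) y y +
    (-(1 / σ ^ 2) ^ 2) • (inner ℝ y (centredSum k μ) : ℝ) • G y μ

section Step

variable {n n' N : ℕ} {σ R : ℝ}
  {G : EuclideanSpace ℝ (Fin n) → (Fin N → EuclideanSpace ℝ (Fin n)) →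
      EuclideanSpace ℝ (Fin n')} {k k' : Fin N}

lemma centredSum_update {i : Fin N} (hi : k < i) (μ : Fin N → EuclideanSpace ℝ (Fin n))
    (x : EuclideanSpace ℝ (Fin n)) : centredSum k (Function.update μ i x) = centredSum k μ := by
  refine Finset.sum_congr rfl fun j hj => ?_
  rw [Function.update_of_ne hi.ne, Function.update_of_ne ((Finset.mem_Iio.1 hj).trans hi).ne]

lemma contDiff_centredSum (k : Fin N) :
    ContDiff ℝ ∞ (centredSum k : (Fin N → EuclideanSpace ℝ (Fin n)) → _) := by
  unfold centredSum
  fun_prop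

lemma norm_centredSum_le {μ : Fin N → EuclideanSpace ℝ (Fin n)} (hμ : ∀ i, ‖μ i‖ ≤ R) :
    ‖centredSum k μ‖ ≤ 2 * k * R := by
  calc ‖centredSum k μ‖ ≤ ∑ i ∈ Finset.Iio k, (R + R) :=
        norm_sum_le_of_le _ fun i _ => (norm_sub_le _ _).trans (add_le_add (hμ i) (hμ k))
    _ = 2 * k * R := by simp; ring

lemma ouStep_update (hk : ∀ y μ i x, k ≤ i → G y (Function.update μ i x) = G y μ)
    (hkk' : k < k') (y : EuclideanSpace ℝ (Fin n)) (μ : Fin N → EuclideanSpace ℝ (Fin n))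
    {i : Fin N} (x : EuclideanSpace ℝ (Fin n)) (hi : k' < i) :
    ouStep σ k k' G y (Function.update μ i x) = ouStep σ k k' G y μ := by
  have h : ∀ y, G y (Function.update μ i x) = G y μ :=
    fun y => hk y μ i x (hkk'.trans hi).le
  simp only [ouStep, h, centredSum_update (hkk'.trans hi), centredSum_update hi]

lemma contDiff_ouStep
    (hG : ContDiff ℝ ∞
      (fun q : EuclideanSpace ℝ (Fin n) × (Fin N → EuclideanSpace ℝ (Fin n)) => G q.1 q.2)) :
    ContDiff ℝ ∞ (fun q : EuclideanSpace ℝ (Fin n) × (Fin N → EuclideanSpace ℝ (Fin n)) =>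
      ouStep σ k k' G q.1 q.2) := by
  have hu : ∀ k : Fin N, ContDiff ℝ ∞
      (fun q : EuclideanSpace ℝ (Fin n) × (Fin N → EuclideanSpace ℝ (Fin n)) =>
        centredSum k q.2) := fun k => (contDiff_centredSum k).comp contDiff_snd
  have hD := hG.fderiv_left
  have hL : ContDiff ℝ ∞
      (fun q : EuclideanSpace ℝ (Fin n) × (Fin N → EuclideanSpace ℝ (Fin n)) =>
        Laplacian.laplacian (fun y => G y q.2) q.1) := by
    simp_rw [fun μ y => laplacian_eq_sum_fderiv (EuclideanSpace.basisFun (Fin n) ℝ)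
      (hG.left_section μ) y]
    refine ContDiff.sum fun a _ => ?_
    exact (ContDiff.fderiv_left
      (H := fun y μ => fderiv ℝ (fun y => G y μ) y (EuclideanSpace.basisFun (Fin n) ℝ a))
      (hD.clm_apply contDiff_const)).clm_apply contDiff_const
  exact (((hL.add ((hD.clm_apply ((hu k).add (hu k'))).const_smul _)).add
    ((contDiff_const.mul ((hu k).inner ℝ (hu k'))).smul hG)).add
    ((hD.clm_apply contDiff_fst).const_smul _)).add
    (((contDiff_fst.inner ℝ (hu k)).smul hG).const_smul _)

/-- The pointwise identity behind `ouGenerator_replicaMean`: conjugated by the weights, the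
directional derivatives become `D_v + s ⟪v, u⟫`, and they are contracted over an orthonormal
basis. -/
lemma sum_twisted_fderiv {E F ι : Type} [NormedAddCommGroup E] [InnerProductSpace ℝ E]
    [FiniteDimensional ℝ E] [NormedAddCommGroup F] [NormedSpace ℝ F] [Fintype ι]
    (b : OrthonormalBasis ι ℝ E) {g : E → F} (hg : ContDiff ℝ ∞ g) (s : ℝ) (u u' y : E) :
    ∑ a, (fderiv ℝ (fun x => fderiv ℝ g x (b a) + (s * inner ℝ (b a) u) • g x) y (b a) +
      (s * inner ℝ (b a) u') • (fderiv ℝ g y (b a) + (s * inner ℝ (b a) u) • g y)) =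
    Laplacian.laplacian g y + s • fderiv ℝ g y (u + u') + (s ^ 2 * inner ℝ u u') • g y := by
  have hD : ∀ w, DifferentiableAt ℝ (fun x => fderiv ℝ g x w) y := fun w =>
    ((hg.fderiv_right (m := ∞) (by simp)).clm_apply contDiff_const).differentiable (by simp) y
  have hd : DifferentiableAt ℝ g y := hg.differentiable (by simp) y
  have hv : ∀ v : E, fderiv ℝ g y v = ∑ a, (inner ℝ (b a) v : ℝ) • fderiv ℝ g y (b a) := by
    intro v
    conv_lhs => rw [← b.sum_repr' v]
    simp
  rw [laplacian_eq_sum_fderiv b hg, map_add, hv u, hv u', ← b.sum_inner_mul_inner u u',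
    Finset.mul_sum, Finset.sum_smul, ← Finset.sum_add_distrib, Finset.smul_sum,
    ← Finset.sum_add_distrib, ← Finset.sum_add_distrib]
  refine Finset.sum_congr rfl fun a _ => ?_
  rw [fderiv_fun_add (hD _) (hd.fun_const_smul _), fderiv_fun_const_smul hd]
  simp only [_root_.add_apply, _root_.smul_apply, real_inner_comm (b a) u]
  module

end Step

section Generator

variable {n n' N : ℕ} {σ R : ℝ} {Q : Measure (EuclideanSpace ℝ (Fin n))}
  [IsProbabilityMeasure Q]
  {G : EuclideanSpace ℝ (Fin n) → (Fin (N + 1) → EuclideanSpace ℝ (Fin n)) →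
      EuclideanSpace ℝ (Fin n')} {k k' : Fin (N + 1)}

/-- `ℒ` acts on posterior expectations through an operator on observables, at the price of two
further replicas. -/
lemma ouGenerator_replicaMean (hQ : ∀ᵐ x ∂Q, x ∈ Metric.closedBall 0 R)
    (hG : ContDiff ℝ ∞
      (fun q : EuclideanSpace ℝ (Fin n) × (Fin (N + 1) → EuclideanSpace ℝ (Fin n)) => G q.1 q.2))
    (hk : ∀ y μ i x, k ≤ i → G y (Function.update μ i x) = G y μ)
    (hkk' : k < k') :
    ouGenerator σ (replicaMean Q σ G) = replicaMean Q σ (ouStep σ k k' G) := by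
  funext y
  set b := EuclideanSpace.basisFun (Fin n) ℝ
  set s := 1 / σ ^ 2 with hs
  set G₁ : EuclideanSpace ℝ (Fin n) → EuclideanSpace ℝ (Fin n) →
      (Fin (N + 1) → EuclideanSpace ℝ (Fin n)) → EuclideanSpace ℝ (Fin n') := fun v y μ =>
    fderiv ℝ (fun y => G y μ) y v + (s * inner ℝ v (centredSum k μ)) • G y μ with hG₁
  have hu : ContDiff ℝ ∞
      (fun q : EuclideanSpace ℝ (Fin n) × (Fin (N + 1) → EuclideanSpace ℝ (Fin n)) =>
        centredSum k q.2) := (contDiff_centredSum k).comp contDiff_snd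
  have hG₁s : ∀ v, ContDiff ℝ ∞
      (fun q : EuclideanSpace ℝ (Fin n) × (Fin (N + 1) → EuclideanSpace ℝ (Fin n)) =>
        G₁ v q.1 q.2) := fun v =>
    (hG.fderiv_left.clm_apply contDiff_const).add
      ((contDiff_const.mul (contDiff_const.inner ℝ hu)).smul hG)
  have h1 : ∀ v x, fderiv ℝ (replicaMean Q σ G) x v = replicaMean Q σ (G₁ v) x :=
    fun v x => fderiv_replicaMean hQ hG hk x v
  have h2 : ∀ v, fderiv ℝ (replicaMean Q σ (G₁ v)) y v = replicaMean Q σ (fun y μ =>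
      fderiv ℝ (fun y => G₁ v y μ) y v + (s * inner ℝ v (centredSum k' μ)) • G₁ v y μ) y := by
    refine fun v => fderiv_replicaMean hQ (hG₁s v) (fun y μ i x hi => ?_) y v
    have hki := hkk'.trans_le hi
    simp only [hG₁, hk _ μ i x hki.le, centredSum_update hki]
  have hc : ∀ v, Continuous (fun μ : Fin (N + 1) → EuclideanSpace ℝ (Fin n) =>
      fderiv ℝ (fun y => G₁ v y μ) y v + (s * inner ℝ v (centredSum k' μ)) • G₁ v y μ) :=
    fun v => (((hG₁s v).continuous_fderiv_left y).clm_apply continuous_const).add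
      (Continuous.smul (f := fun μ => s * inner ℝ v (centredSum k' μ))
        (continuous_const.mul (continuous_const.inner (contDiff_centredSum k').continuous))
        ((hG₁s v).continuous_right_section y))
  have hpt : ∀ μ, ouStep σ k k' G y μ =
      ∑ a, (fderiv ℝ (fun y => G₁ (b a) y μ) y (b a) +
        (s * inner ℝ (b a) (centredSum k' μ)) • G₁ (b a) y μ) - s • G₁ y y μ := by
    intro μ
    have := sum_twisted_fderiv b (hG.left_section μ) s (centredSum k μ) (centredSum k' μ) y
    simp only [hG₁, this, ouStep, ← hs]
    module
  calc ouGenerator σ (replicaMean Q σ G) y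
      = ∑ a, replicaMean Q σ (fun y μ => fderiv ℝ (fun y => G₁ (b a) y μ) y (b a) +
          (s * inner ℝ (b a) (centredSum k' μ)) • G₁ (b a) y μ) y -
          s • replicaMean Q σ (G₁ y) y := by
        simp only [ouGenerator, laplacian_eq_sum_fderiv b (contDiff_replicaMean hQ hG), h1, h2,
          ← hs]
        abel
    _ = replicaMean Q σ (fun y' μ => ∑ a, (fderiv ℝ (fun y => G₁ (b a) y μ) y' (b a) +
          (s * inner ℝ (b a) (centredSum k' μ)) • G₁ (b a) y' μ) - s • G₁ y y' μ) y := by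
        rw [← replicaMean_sum hQ _ fun a _ => hc (b a), ← replicaMean_const_smul,
          ← replicaMean_sub hQ (continuous_finsetSum _ fun a _ => hc (b a))
            (((hG₁s y).continuous_right_section y).const_smul s)]
    _ = replicaMean Q σ (ouStep σ k k' G) y := by
        simp only [replicaMean, hpt]

end Generator

section StepBound

variable {n n' N : ℕ} {σ R M : ℝ}
  {G : EuclideanSpace ℝ (Fin n) → (Fin N → EuclideanSpace ℝ (Fin n)) →
      EuclideanSpace ℝ (Fin n')} {k k' : Fin N}

lemma PolyBound.inner_centredSum_smul {F : Type} [NormedAddCommGroup F] [NormedSpace ℝ F]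
    {μ : Fin N → EuclideanSpace ℝ (Fin n)} {d : ℕ} {c : ℝ} {g : EuclideanSpace ℝ (Fin n) → F}
    (h : PolyBound (Set.range μ) M d c g) (k : Fin N) :
    PolyBound (Set.range μ) M (d + 1) (2 * k * (M * c))
      (fun y => (inner ℝ y (centredSum k μ) : ℝ) • g y) := by
  have := PolyBound.sum (Finset.Iio k) fun i _ =>
    (h.mul (Set.mem_range_self i)).add ((h.mul (Set.mem_range_self k)).const_smul (-1))
  simp only [Finset.sum_const, Fin.card_Iio, nsmul_eq_mul] at this
  convert! this using 1
  · rw [abs_neg, abs_one]; ring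
  · funext y
    simp only [centredSum, inner_sum, Finset.sum_smul, inner_sub_right, sub_smul]
    exact Finset.sum_congr rfl fun i _ => by module

/-- The cost of one application of `ℒ` to a polynomial observable. Each of the five terms of
`ouStep` is compared with `m² s² M`, by means of `R² ≤ M` and `1 ≤ s M`. -/
lemma PolyBound.ouStep {μ : Fin N → EuclideanSpace ℝ (Fin n)} {d m : ℕ} {c : ℝ}
    (hμ : ∀ i, ‖μ i‖ ≤ R) (hσ : 0 < σ) (hσR : σ ≤ R) (hM : R ^ 2 ≤ M)
    (hm : d + 1 ≤ m) (hkm : (k : ℕ) ≤ 2 * m) (hkm' : (k' : ℕ) ≤ 2 * m)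
    (h : PolyBound (Set.range μ) M d c (fun y => G y μ)) :
    PolyBound (Set.range μ) M (d + 1) (30 * (m ^ 2 * (1 / σ ^ 2) ^ 2 * M) * c)
      (fun y => ouStep σ k k' G y μ) := by
  have hR : 0 < R := hσ.trans_le hσR
  have hM0 : 0 < M := (by positivity : 0 < R ^ 2).trans_le hM
  have hc := h.nonneg hM0.le
  set s := 1 / σ ^ 2 with hs
  have hs0 : 0 < s := by positivity
  have hsM : 1 ≤ s * M := by
    rw [hs, one_div, inv_mul_eq_div, one_le_div (by positivity)]
    exact (pow_le_pow_left₀ hσ.le hσR 2).trans hM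
  have hV : ∀ v ∈ Set.range μ, ‖v‖ ≤ R := by
    rintro _ ⟨i, rfl⟩
    exact hμ i
  have hd : (d : ℝ) ≤ m := by exact_mod_cast (Nat.le_succ d).trans hm
  have hm1 : (1 : ℝ) ≤ m := by exact_mod_cast (Nat.le_add_left 1 d).trans hm
  have hmm : (m : ℝ) ≤ m ^ 2 := by nlinarith
  have hk : (k : ℝ) ≤ 2 * m := by exact_mod_cast hkm
  have hk' : (k' : ℝ) ≤ 2 * m := by exact_mod_cast hkm'
  have hu : ‖centredSum k μ‖ ≤ 4 * m * R := (norm_centredSum_le hμ).trans (by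
    have := mul_le_mul_of_nonneg_right hk hR.le
    linarith)
  have hu' : ‖centredSum k' μ‖ ≤ 4 * m * R := (norm_centredSum_le hμ).trans (by
    have := mul_le_mul_of_nonneg_right hk' hR.le
    linarith)
  have e1 : ((d : ℝ) * R / M) ^ 2 ≤ m ^ 2 * s ^ 2 * M := by
    rw [div_pow, mul_pow, div_le_iff₀ (by positivity)]
    calc (d : ℝ) ^ 2 * R ^ 2 ≤ m ^ 2 * M := by gcongr
      _ ≤ m ^ 2 * M * (s * M) ^ 2 :=
        le_mul_of_one_le_right (by positivity) (one_le_pow₀ hsM)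
      _ = _ := by ring
  have e2 : |s| * (d * (‖centredSum k μ + centredSum k' μ‖ * R / M)) ≤
      8 * (m ^ 2 * s ^ 2 * M) := by
    have hn : ‖centredSum k μ + centredSum k' μ‖ ≤ 8 * m * R :=
      (norm_add_le _ _).trans (by linarith)
    have : ‖centredSum k μ + centredSum k' μ‖ * R / M ≤ 8 * m := by
      rw [div_le_iff₀ hM0]
      calc _ ≤ 8 * m * R * R := by gcongr
        _ = 8 * m * R ^ 2 := by ring
        _ ≤ _ := by gcongr
    calc |s| * (d * (‖centredSum k μ + centredSum k' μ‖ * R / M))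
        ≤ s * (m * (8 * m)) := by rw [abs_of_pos hs0]; gcongr
      _ ≤ s * (m * (8 * m)) * (s * M) := le_mul_of_one_le_right (by positivity) hsM
      _ = _ := by ring
  have e3 : |s ^ 2 * inner ℝ (centredSum k μ) (centredSum k' μ)| ≤
      16 * (m ^ 2 * s ^ 2 * M) := by
    rw [abs_mul, abs_of_pos (by positivity : 0 < s ^ 2)]
    calc s ^ 2 * |inner ℝ (centredSum k μ) (centredSum k' μ)|
        ≤ s ^ 2 * (‖centredSum k μ‖ * ‖centredSum k' μ‖) := by
          gcongr
          exact abs_real_inner_le_norm _ _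
      _ ≤ s ^ 2 * ((4 * m * R) * (4 * m * R)) := by gcongr
      _ = 16 * (m ^ 2 * s ^ 2 * R ^ 2) := by ring
      _ ≤ _ := by gcongr
  have e4 : |-s| * d ≤ m ^ 2 * s ^ 2 * M := by
    rw [abs_neg, abs_of_pos hs0]
    calc s * d ≤ s * m ^ 2 := by gcongr; exact hd.trans hmm
      _ ≤ s * m ^ 2 * (s * M) := le_mul_of_one_le_right (by positivity) hsM
      _ = _ := by ring
  have e5 : |-s ^ 2| * (2 * k * M) ≤ 4 * (m ^ 2 * s ^ 2 * M) := by
    rw [abs_neg, abs_of_pos (by positivity : 0 < s ^ 2)]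
    calc s ^ 2 * (2 * k * M) ≤ s ^ 2 * (2 * (2 * m ^ 2) * M) := by gcongr; linarith
      _ = _ := by ring
  have key := (((((h.laplacian hM0 hR.le hV).add
    ((h.fderiv_apply hM0 hR.le hV (centredSum k μ + centredSum k' μ)).const_smul s)).add
    (h.const_smul (s ^ 2 * inner ℝ (centredSum k μ) (centredSum k' μ)))).add
    ((h.fderiv_self hM0.le).const_smul (-s))).mono (Nat.le_succ d) le_rfl).add
    ((h.inner_centredSum_smul k).const_smul (-s ^ 2))
  refine key.mono le_rfl ?_
  calc _ = ((d * R / M) ^ 2 + |s| * (d * (‖centredSum k μ + centredSum k' μ‖ * R / M)) +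
        |s ^ 2 * inner ℝ (centredSum k μ) (centredSum k' μ)| + |-s| * d +
        |-s ^ 2| * (2 * k * M)) * c := by ring
    _ ≤ (m ^ 2 * s ^ 2 * M + 8 * (m ^ 2 * s ^ 2 * M) + 16 * (m ^ 2 * s ^ 2 * M) +
        m ^ 2 * s ^ 2 * M + 4 * (m ^ 2 * s ^ 2 * M)) * c := by gcongr
    _ = _ := by ring

end StepBound

/-! ### Iterates of the generator -/

section Iterates

variable {n N : ℕ} {σ R M : ℝ} {Q : Measure (EuclideanSpace ℝ (Fin n))} [IsProbabilityMeasure Q]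

/-- The posterior expectation of a function of a single replica. -/
lemma replicaMean_eval (hQ : ∀ᵐ x ∂Q, x ∈ Metric.closedBall 0 R)
    (φ : EuclideanSpace ℝ (Fin n) → EuclideanSpace ℝ (Fin n) → ℝ) (i : Fin (N + 1))
    (y : EuclideanSpace ℝ (Fin n)) :
    replicaMean Q σ (fun y μ => φ y (μ i)) y =
      (∫ x, posteriorWeight σ y x ∂Q)⁻¹ * ∫ x, posteriorWeight σ y x * φ y x ∂Q := by
  have h := replicaMean_smul_of_update (F := ℝ) (N := N) (i := i) (σ := σ) hQ φ
    (G := fun _ _ => 1) y fun _ _ => rfl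
  simp only [smul_eq_mul, mul_one] at h
  rw [h]
  simp only [replicaMean, smul_eq_mul, mul_one]
  rw [inv_mul_cancel₀ (integral_replicaWeight_pos hQ y).ne', mul_one]

lemma continuous_posteriorWeight (y : EuclideanSpace ℝ (Fin n)) :
    Continuous (posteriorWeight σ y) :=
  contDiff_posteriorWeight.continuous_right_section y

lemma integrable_of_continuous_of_ae_mem_closedBall {F : Type} [NormedAddCommGroup F]
    (hQ : ∀ᵐ x ∂Q, x ∈ Metric.closedBall 0 R) {h : EuclideanSpace ℝ (Fin n) → F}
    (hh : Continuous h) : Integrable h Q :=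
  integrable_of_continuous_of_ae_mem_compact (isCompact_closedBall _ _) hQ hh

lemma integral_posteriorWeight_pos (hQ : ∀ᵐ x ∂Q, x ∈ Metric.closedBall 0 R)
    (y : EuclideanSpace ℝ (Fin n)) : 0 < ∫ x, posteriorWeight σ y x ∂Q :=
  integral_exp_pos (integrable_of_continuous_of_ae_mem_closedBall hQ
    (continuous_posteriorWeight y))

lemma posteriorMean_eq_replicaMean (hQ : ∀ᵐ x ∂Q, x ∈ Metric.closedBall 0 R) :
    posteriorMean Q σ =
      replicaMean Q σ (fun _ (μ : Fin (N + 1) → EuclideanSpace ℝ (Fin n)) => μ 0) := by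
  funext y
  -- tested against a fixed vector, the claim is about a scalar function of one replica
  refine ext_inner_left ℝ fun v => ?_
  have h := replicaMean_eval (N := N) (σ := σ) hQ (fun _ x => inner ℝ v x) 0 y
  have h1 : Integrable (fun x => posteriorWeight σ y x • x) Q :=
    integrable_of_continuous_of_ae_mem_closedBall hQ
      ((continuous_posteriorWeight y).smul continuous_id)
  have h2 := integrable_replicaWeight_smul (σ := σ) hQ y
    (continuous_apply (A := fun _ : Fin (N + 1) => EuclideanSpace ℝ (Fin n)) 0)
  rw [posteriorMean, inner_smul_right, ← integral_inner h1]
  simp only [inner_smul_right]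
  rw [← h, replicaMean, replicaMean, inner_smul_right, ← integral_inner h2]
  simp only [inner_smul_right, smul_eq_mul]

/-- All iterates `ℒ^j f` with `j ≤ m` are posterior expectations of polynomial observables of
`2 m + 1` replicas, of degree at most `j` and with controlled coefficients. -/
lemma exists_observable_iterate_ouGenerator (hQ : ∀ᵐ x ∂Q, x ∈ Metric.closedBall 0 R)
    (hσ : 0 < σ) (hσR : σ ≤ R) (hM : R ^ 2 ≤ M) {m j : ℕ} (hj : j ≤ m) :
    ∃ G : EuclideanSpace ℝ (Fin n) → (Fin (2 * m + 1) → EuclideanSpace ℝ (Fin n)) →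
        EuclideanSpace ℝ (Fin n),
      ContDiff ℝ ∞ (fun q : EuclideanSpace ℝ (Fin n) ×
        (Fin (2 * m + 1) → EuclideanSpace ℝ (Fin n)) => G q.1 q.2) ∧
      (∀ y μ (i : Fin (2 * m + 1)) x, 2 * j + 1 ≤ (i : ℕ) →
        G y (Function.update μ i x) = G y μ) ∧
      (∀ μ, (∀ i, ‖μ i‖ ≤ R) → PolyBound (Set.range μ) M j
        ((30 * (m ^ 2 * (1 / σ ^ 2) ^ 2 * M)) ^ j * R) (fun y => G y μ)) ∧
      (ouGenerator σ)^[j] (posteriorMean Q σ) = replicaMean Q σ G := by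
  induction j with
  | zero =>
    refine ⟨fun _ μ => μ 0, (contDiff_apply ℝ _ 0).comp contDiff_snd, fun y μ i x hi => ?_,
      fun μ hμ => ?_, posteriorMean_eq_replicaMean hQ⟩
    · refine Function.update_of_ne ?_ _ _
      rintro rfl
      simp at hi
    · exact (PolyBound.const 0 (μ 0)).mono le_rfl (by simpa using hμ 0)
  | succ j ih =>
    obtain ⟨G, hG, hdep, hbd, hit⟩ := ih (by omega)
    set k : Fin (2 * m + 1) := ⟨2 * j + 1, by omega⟩ with hk
    set k' : Fin (2 * m + 1) := ⟨2 * j + 2, by omega⟩ with hk'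
    have hkk' : k < k' := by simp [hk, hk', Fin.lt_def]
    have hdep' : ∀ y μ i x, k ≤ i → G y (Function.update μ i x) = G y μ :=
      fun y μ i x hi => hdep y μ i x (by simpa [hk, Fin.le_def] using hi)
    refine ⟨ouStep σ k k' G, contDiff_ouStep hG, fun y μ i x hi =>
      ouStep_update hdep' hkk' y μ x (by simp only [hk', Fin.lt_def]; omega), fun μ hμ => ?_, ?_⟩
    · convert! (hbd μ hμ).ouStep (k := k) (k' := k') hμ hσ hσR hM hj
        (by simp only [hk]; omega) (by simp only [hk']; omega) using 1
      rw [pow_succ']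
      ring
    · rw [Function.iterate_succ_apply', hit, ouGenerator_replicaMean hQ hG hdep' hkk']

lemma contDiff_iterate_ouGenerator_posteriorMean (hQ : ∀ᵐ x ∂Q, x ∈ Metric.closedBall 0 R)
    (hσ : 0 < σ) (hσR : σ ≤ R) (m : ℕ) :
    ContDiff ℝ ∞ ((ouGenerator σ)^[m] (posteriorMean Q σ)) := by
  obtain ⟨G, hG, -, -, hit⟩ :=
    exists_observable_iterate_ouGenerator hQ hσ hσR le_rfl (le_refl m)
  rw [hit]
  exact contDiff_replicaMean hQ hG

lemma PolyBound.norm_le_sum_exp {F : Type} [NormedAddCommGroup F] [NormedSpace ℝ F]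
    {μ : Fin (N + 1) → EuclideanSpace ℝ (Fin n)} {d : ℕ} {c : ℝ}
    {g : EuclideanSpace ℝ (Fin n) → F} (hM : 0 < M) (h : PolyBound (Set.range μ) M d c g)
    (y : EuclideanSpace ℝ (Fin n)) :
    ‖g y‖ ≤ c * ∑ i, Real.exp (d / M * |inner ℝ y (μ i)|) := by
  obtain ⟨i, -, hi⟩ := Finset.exists_max_image Finset.univ (fun i => |(inner ℝ y (μ i) : ℝ)|)
    Finset.univ_nonempty
  have hX : 0 ≤ |(inner ℝ y (μ i) : ℝ)| / M := by positivity
  refine (h.norm_le hM hX ?_).trans (mul_le_mul_of_nonneg_left ?_ (h.nonneg hM.le))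
  · rintro _ ⟨j, rfl⟩
    rw [mul_div_cancel₀ _ hM.ne']
    exact hi j (Finset.mem_univ j)
  · calc (1 + |(inner ℝ y (μ i) : ℝ)| / M) ^ d
        ≤ Real.exp (|(inner ℝ y (μ i) : ℝ)| / M) ^ d := by
          gcongr
          rw [add_comm]
          exact Real.add_one_le_exp _
      _ = Real.exp (d / M * |inner ℝ y (μ i)|) := by
          rw [← Real.exp_nat_mul]
          ring_nf
      _ ≤ _ := Finset.single_le_sum
          (f := fun i => Real.exp (d / M * |(inner ℝ y (μ i) : ℝ)|))
          (fun _ _ => (Real.exp_pos _).le) (Finset.mem_univ i)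

/-- The pointwise, dimension-free bound for the iterates. The exponential moment is that of a single
replica, since all replicas have the same law. -/
lemma norm_iterate_ouGenerator_posteriorMean_le (hQ : ∀ᵐ x ∂Q, x ∈ Metric.closedBall 0 R)
    (hσ : 0 < σ) (hσR : σ ≤ R) (hM : R ^ 2 ≤ M) (m : ℕ) (y : EuclideanSpace ℝ (Fin n)) :
    ‖(ouGenerator σ)^[m] (posteriorMean Q σ) y‖ ≤
      (30 * (m ^ 2 * (1 / σ ^ 2) ^ 2 * M)) ^ m * R * (2 * m + 1) *
        ((∫ x, posteriorWeight σ y x ∂Q)⁻¹ *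
          ∫ x, posteriorWeight σ y x * Real.exp (m / M * |inner ℝ y x|) ∂Q) := by
  obtain ⟨G, hG, -, hbd, hit⟩ :=
    exists_observable_iterate_ouGenerator hQ hσ hσR hM (le_refl m)
  have hR : 0 < R := hσ.trans_le hσR
  have hM0 : 0 < M := (by positivity : 0 < R ^ 2).trans_le hM
  set c := (30 * (m ^ 2 * (1 / σ ^ 2) ^ 2 * M)) ^ m * R
  have hpos := integral_replicaWeight_pos (N := 2 * m + 1) (σ := σ) hQ y
  have hcont : ∀ i : Fin (2 * m + 1), Continuous
      (fun μ : Fin (2 * m + 1) → EuclideanSpace ℝ (Fin n) =>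
        Real.exp (m / M * |inner ℝ y (μ i)|)) := fun i =>
    Real.continuous_exp.comp
      (continuous_const.mul (continuous_const.inner (continuous_apply i)).abs)
  have h1 : ‖replicaMean Q σ G y‖ ≤ replicaMean Q σ (fun y μ =>
      c • ∑ i : Fin (2 * m + 1), Real.exp (m / M * |inner ℝ y (μ i)|)) y := by
    rw [replicaMean, replicaMean, norm_smul, norm_inv, Real.norm_of_nonneg hpos.le, smul_eq_mul]
    gcongr
    refine norm_integral_le_of_norm_le (integrable_replicaWeight_smul hQ y
      ((continuous_finsetSum _ fun i _ => hcont i).const_smul c)) ?_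
    filter_upwards [ae_pi_mem_closedBall hQ] with μ hμ
    have hμ' : ∀ i, ‖μ i‖ ≤ R := fun i => by simpa using hμ i (Set.mem_univ i)
    rw [norm_smul, Real.norm_of_nonneg (replicaWeight_pos y μ).le, smul_eq_mul]
    exact mul_le_mul_of_nonneg_left ((hbd μ hμ').norm_le_sum_exp hM0 y)
      (replicaWeight_pos y μ).le
  rw [hit]
  refine h1.trans (le_of_eq ?_)
  rw [replicaMean_const_smul, replicaMean_sum hQ _ fun i _ => hcont i,
    Finset.sum_congr rfl fun i _ =>
      replicaMean_eval hQ (fun y x => Real.exp (m / M * |inner ℝ y x|)) i y]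
  simp
  ring

end Iterates

/-! ### Gaussian exponential moments and Jensen's inequality -/

section GaussianMoments

variable {n : ℕ} {σ R : ℝ}

instance isProbabilityMeasure_gaussianVar : IsProbabilityMeasure (gaussianVar n σ) :=
  Measure.isProbabilityMeasure_map (by fun_prop)

lemma lintegral_exp_inner_gaussianVar (v : EuclideanSpace ℝ (Fin n)) :
    ∫⁻ g, ENNReal.ofReal (Real.exp (inner ℝ g v)) ∂gaussianVar n σ =
      ENNReal.ofReal (Real.exp (σ ^ 2 * ‖v‖ ^ 2 / 2)) := by
  have hlaw : (stdGaussian (EuclideanSpace ℝ (Fin n))).map (innerSL ℝ v) =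
      gaussianReal 0 (‖v‖ ^ 2).toNNReal := by
    rw [IsGaussian.map_eq_gaussianReal, variance_dual_stdGaussian, innerSL_apply_norm]
    congr 1
    exact integral_strongDual_stdGaussian _
  have hmgf := mgf_gaussianReal hlaw σ
  rw [Real.coe_toNNReal _ (by positivity)] at hmgf
  have hint : Integrable (fun x => Real.exp (σ * innerSL ℝ v x))
      (stdGaussian (EuclideanSpace ℝ (Fin n))) := by
    rw [← mgf_pos_iff, hmgf]
    exact Real.exp_pos _
  rw [gaussianVar, lintegral_map (by fun_prop) (by fun_prop)]
  have : ∀ x : EuclideanSpace ℝ (Fin n), inner ℝ (σ • x) v = σ * innerSL ℝ v x := fun x => by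
    rw [real_inner_smul_left, innerSL_apply_apply, real_inner_comm]
  simp only [this]
  rw [← ofReal_integral_eq_lintegral_ofReal hint (.of_forall fun _ => (Real.exp_pos _).le)]
  congr 1
  refine hmgf.trans ?_
  congr 1
  ring

lemma posteriorWeight_mul_inv (y x z : EuclideanSpace ℝ (Fin n)) :
    posteriorWeight σ y x * (posteriorWeight σ y z)⁻¹ =
      Real.exp (inner ℝ y ((1 / σ ^ 2) • (x - z)) + (‖z‖ ^ 2 - ‖x‖ ^ 2) / (2 * σ ^ 2)) := by
  rw [posteriorWeight, posteriorWeight, ← Real.exp_neg, ← Real.exp_add, real_inner_smul_right,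
    inner_sub_right]
  congr 1
  ring

lemma norm_smul_sub_add_smul_le (hσ : 0 < σ) (hσR : σ ≤ R) {t : ℝ} (ht : R / σ ≤ t)
    {x z : EuclideanSpace ℝ (Fin n)} (hx : ‖x‖ ≤ R) (hz : ‖z‖ ≤ R) {r : ℝ}
    (hr : |r| ≤ t / (σ * R)) : ‖(1 / σ ^ 2) • (x - z) + r • x‖ ≤ 3 * t / σ := by
  have hR : 0 < R := hσ.trans_le hσR
  have h1 : ‖x - z‖ ≤ R + R := (norm_sub_le _ _).trans (add_le_add hx hz)
  calc ‖(1 / σ ^ 2) • (x - z) + r • x‖ ≤ 1 / σ ^ 2 * ‖x - z‖ + |r| * ‖x‖ := by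
        refine (norm_add_le _ _).trans_eq ?_
        rw [norm_smul, norm_smul, Real.norm_of_nonneg (by positivity), Real.norm_eq_abs]
    _ ≤ 1 / σ ^ 2 * (R + R) + t / (σ * R) * R := by
        have := (abs_nonneg r).trans hr
        gcongr
    _ = (2 * (R / σ) + t) / σ := by field_simp; ring
    _ ≤ 3 * t / σ := by gcongr; linarith

/-- The exponential moment behind both estimates. Since `t` dominates `R / σ`, every exponent that
occurs, the ratio of the weights included, costs only a constant multiple of `t ^ 2`. -/
lemma lintegral_exp_abs_mul_posteriorWeight_le (hσ : 0 < σ) (hσR : σ ≤ R) {t : ℝ}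
    (ht : R / σ ≤ t) {a x z : EuclideanSpace ℝ (Fin n)} (ha : ‖a‖ ≤ R) (hx : ‖x‖ ≤ R)
    (hz : ‖z‖ ≤ R) :
    ∫⁻ g, ENNReal.ofReal (Real.exp (t / (σ * R) * |inner ℝ (a + g) x|) *
      (posteriorWeight σ (a + g) x * (posteriorWeight σ (a + g) z)⁻¹)) ∂gaussianVar n σ ≤
      ENNReal.ofReal (2 * Real.exp (8 * t ^ 2)) := by
  have hR : 0 < R := hσ.trans_le hσR
  have ht0 : 0 < t := (by positivity : 0 < R / σ).trans_le ht
  set r := t / (σ * R) with hr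
  have hr0 : 0 < r := by positivity
  have key : ∀ r', |r'| = r →
      ∫⁻ g, ENNReal.ofReal (Real.exp (R ^ 2 / (2 * σ ^ 2) + inner ℝ (a + g)
        ((1 / σ ^ 2) • (x - z) + r' • x))) ∂gaussianVar n σ ≤
        ENNReal.ofReal (Real.exp (8 * t ^ 2)) := by
    intro r' hr'
    have hv := norm_smul_sub_add_smul_le hσ hσR ht hx hz hr'.le
    set v := (1 / σ ^ 2) • (x - z) + r' • x
    have hsplit : ∀ g, ENNReal.ofReal (Real.exp (R ^ 2 / (2 * σ ^ 2) + inner ℝ (a + g) v)) =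
        ENNReal.ofReal (Real.exp (R ^ 2 / (2 * σ ^ 2) + inner ℝ a v)) *
          ENNReal.ofReal (Real.exp (inner ℝ g v)) := fun g => by
      rw [← ENNReal.ofReal_mul (Real.exp_pos _).le, ← Real.exp_add, inner_add_left, add_assoc]
    simp only [hsplit]
    rw [lintegral_const_mul _ (by fun_prop), lintegral_exp_inner_gaussianVar,
      ← ENNReal.ofReal_mul (Real.exp_pos _).le, ← Real.exp_add]
    refine ENNReal.ofReal_le_ofReal (Real.exp_le_exp.2 ?_)
    have hRt : R ≤ t * σ := (div_le_iff₀ hσ).1 ht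
    have h1 : R ^ 2 / (2 * σ ^ 2) ≤ t ^ 2 / 2 := by
      rw [div_le_div_iff₀ (by positivity) two_pos]
      nlinarith [mul_le_mul hRt hRt hR.le (by positivity)]
    have h2 : inner ℝ a v ≤ 3 * t ^ 2 := by
      calc inner ℝ a v ≤ ‖a‖ * ‖v‖ := real_inner_le_norm _ _
        _ ≤ (t * σ) * (3 * t / σ) := by gcongr; exact ha.trans hRt
        _ = 3 * t ^ 2 := by field_simp
    have h3 : σ ^ 2 * ‖v‖ ^ 2 / 2 ≤ 9 / 2 * t ^ 2 := by
      calc σ ^ 2 * ‖v‖ ^ 2 / 2 ≤ σ ^ 2 * (3 * t / σ) ^ 2 / 2 := by gcongr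
        _ = 9 / 2 * t ^ 2 := by field_simp; ring
    linarith
  have hpt : ∀ g, Real.exp (r * |inner ℝ (a + g) x|) *
      (posteriorWeight σ (a + g) x * (posteriorWeight σ (a + g) z)⁻¹) ≤
      Real.exp (R ^ 2 / (2 * σ ^ 2) + inner ℝ (a + g) ((1 / σ ^ 2) • (x - z) + r • x)) +
      Real.exp (R ^ 2 / (2 * σ ^ 2) + inner ℝ (a + g) ((1 / σ ^ 2) • (x - z) + (-r) • x)) := by
    intro g
    rw [posteriorWeight_mul_inv, ← Real.exp_add]
    have h1 : (‖z‖ ^ 2 - ‖x‖ ^ 2) / (2 * σ ^ 2) ≤ R ^ 2 / (2 * σ ^ 2) := by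
      gcongr
      nlinarith [norm_nonneg x, norm_nonneg z]
    simp only [inner_add_right, real_inner_smul_right _ x]
    rcases abs_cases (inner ℝ (a + g) x : ℝ) with ⟨h, -⟩ | ⟨h, -⟩ <;> rw [h]
    · exact (Real.exp_le_exp.2 (by linarith)).trans (le_add_of_nonneg_right (Real.exp_pos _).le)
    · exact (Real.exp_le_exp.2 (by linarith)).trans (le_add_of_nonneg_left (Real.exp_pos _).le)
  calc _ ≤ ∫⁻ g, (ENNReal.ofReal (Real.exp (R ^ 2 / (2 * σ ^ 2) +
            inner ℝ (a + g) ((1 / σ ^ 2) • (x - z) + r • x))) +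
          ENNReal.ofReal (Real.exp (R ^ 2 / (2 * σ ^ 2) +
            inner ℝ (a + g) ((1 / σ ^ 2) • (x - z) + (-r) • x)))) ∂gaussianVar n σ := by
        refine lintegral_mono fun g => ?_
        rw [← ENNReal.ofReal_add (Real.exp_pos _).le (Real.exp_pos _).le]
        exact ENNReal.ofReal_le_ofReal (hpt g)
    _ ≤ ENNReal.ofReal (Real.exp (8 * t ^ 2)) + ENNReal.ofReal (Real.exp (8 * t ^ 2)) := by
        rw [lintegral_add_left (by fun_prop)]
        exact add_le_add (key r (abs_of_pos hr0)) (key (-r) (by rw [abs_neg, abs_of_pos hr0]))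
    _ = ENNReal.ofReal (2 * Real.exp (8 * t ^ 2)) := by
        rw [← ENNReal.ofReal_add (Real.exp_pos _).le (Real.exp_pos _).le, two_mul]

end GaussianMoments

/-- Jensen's inequality for `u ↦ u ^ p` under a probability measure with unnormalized density `w`,
followed by Jensen's inequality for the inverse of the normalization. -/
lemma rpow_weighted_mean_le {Ω : Type} [MeasurableSpace Ω] {Q : Measure Ω}
    [IsProbabilityMeasure Q] {w u : Ω → ℝ} {p : ℝ} (hp : 1 ≤ p)
    (hw : ∀ x, 0 < w x) (hu : ∀ x, 0 < u x) (hwi : Integrable w Q)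
    (hwi' : Integrable (fun x => (w x)⁻¹) Q)
    (hwu : Integrable (fun x => w x * u x) Q) (hwup : Integrable (fun x => w x * u x ^ p) Q) :
    ((∫ x, w x ∂Q)⁻¹ * ∫ x, w x * u x ∂Q) ^ p ≤
      ∫ z : Ω × Ω, u z.1 ^ p * (w z.1 * (w z.2)⁻¹) ∂(Q.prod Q) := by
  have hpos : ∀ {h : Ω → ℝ}, (∀ x, 0 < h x) → Integrable h Q → 0 < ∫ x, h x ∂Q := by
    intro h hh hi
    rw [integral_pos_iff_support_of_nonneg (fun x => (hh x).le) hi,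
      Set.eq_univ_of_forall fun x => Function.mem_support.2 (hh x).ne']
    simp
  set Z := ∫ x, w x ∂Q with hZ
  set A := ∫ x, w x * u x ∂Q with hA
  have hZ0 : 0 < Z := hpos hw hwi
  have hA0 : 0 < A := hpos (fun x => mul_pos (hw x) (hu x)) hwu
  set U := Z⁻¹ * A with hU
  have hU0 : 0 < U := by positivity
  -- Bernoulli's inequality is the tangent line bound for `u ^ p` at the mean value `U`
  have h1 : U ^ p * Z ≤ ∫ x, w x * u x ^ p ∂Q := by
    have hpt : ∀ x, U ^ p * ((1 - p) * w x + p / U * (w x * u x)) ≤ w x * u x ^ p := by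
      intro x
      have hB := one_add_mul_self_le_rpow_one_add (s := u x / U - 1) (p := p)
        (by have := div_pos (hu x) hU0; linarith) hp
      rw [add_sub_cancel, Real.div_rpow (hu x).le hU0.le, le_div_iff₀ (by positivity)] at hB
      calc U ^ p * ((1 - p) * w x + p / U * (w x * u x))
          = w x * ((1 + p * (u x / U - 1)) * U ^ p) := by ring
        _ ≤ _ := mul_le_mul_of_nonneg_left hB (hw x).le
    calc U ^ p * Z = ∫ x, U ^ p * ((1 - p) * w x + p / U * (w x * u x)) ∂Q := by
          rw [integral_const_mul, integral_add (hwi.const_mul _) (hwu.const_mul _),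
            integral_const_mul, integral_const_mul, ← hZ, ← hA, hU]
          field_simp
          ring
      _ ≤ _ := integral_mono (((hwi.const_mul _).add (hwu.const_mul _)).const_mul _) hwup hpt
  have h2 : Z⁻¹ ≤ ∫ x, (w x)⁻¹ ∂Q := by
    -- the tangent line bound for the inverse at `Z`
    have hpt : ∀ x, 2 * Z⁻¹ - Z⁻¹ ^ 2 * w x ≤ (w x)⁻¹ := by
      intro x
      have : 0 ≤ (w x)⁻¹ * (1 - Z⁻¹ * w x) ^ 2 :=
        mul_nonneg (inv_nonneg.2 (hw x).le) (sq_nonneg _)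
      have hwx := (hw x).ne'
      have e : (w x)⁻¹ * (1 - Z⁻¹ * w x) ^ 2 = (w x)⁻¹ - (2 * Z⁻¹ - Z⁻¹ ^ 2 * w x) := by
        field_simp
        ring
      linarith
    calc Z⁻¹ = ∫ x, (2 * Z⁻¹ - Z⁻¹ ^ 2 * w x) ∂Q := by
          rw [integral_sub (integrable_const _) (hwi.const_mul _), integral_const_mul (Z⁻¹ ^ 2),
            ← hZ, integral_const, probReal_univ, one_smul]
          field_simp
          ring
      _ ≤ _ := integral_mono ((integrable_const _).sub (hwi.const_mul _)) hwi' hpt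
  have h3 : ∫ z : Ω × Ω, u z.1 ^ p * (w z.1 * (w z.2)⁻¹) ∂(Q.prod Q) =
      (∫ x, w x * u x ^ p ∂Q) * ∫ x, (w x)⁻¹ ∂Q := by
    rw [← integral_prod_mul]
    exact integral_congr_ae (.of_forall fun z => by ring)
  rw [h3]
  calc U ^ p = U ^ p * Z * Z⁻¹ := by field_simp
    _ ≤ _ := mul_le_mul h1 h2 (by positivity) (le_trans (by positivity) h1)

section Lp

/-- The observable, of two samples of the prior, that dominates the `p`-th power of the posterior
mean of `exp (r / p * |⟪y, x⟫|)`. -/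
noncomputable def expKernel {n : ℕ} (σ r : ℝ) (y : EuclideanSpace ℝ (Fin n))
    (z : EuclideanSpace ℝ (Fin n) × EuclideanSpace ℝ (Fin n)) : ℝ :=
  Real.exp (r * |inner ℝ y z.1|) * (posteriorWeight σ y z.1 * (posteriorWeight σ y z.2)⁻¹)

variable {n : ℕ} {σ R : ℝ} {Q : Measure (EuclideanSpace ℝ (Fin n))}

lemma ae_prod_mem_closedBall (hQ : ∀ᵐ x ∂Q, x ∈ Metric.closedBall 0 R) :
    ∀ᵐ z ∂(Q.prod Q), z ∈ Metric.closedBall (0 : EuclideanSpace ℝ (Fin n)) R ×ˢ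
      Metric.closedBall (0 : EuclideanSpace ℝ (Fin n)) R := by
  have h1 := (Measure.quasiMeasurePreserving_fst (μ := Q) (ν := Q)).ae hQ
  have h2 := (Measure.quasiMeasurePreserving_snd (μ := Q) (ν := Q)).ae hQ
  filter_upwards [h1, h2] with z hz1 hz2 using ⟨hz1, hz2⟩

variable [IsProbabilityMeasure Q]

lemma continuous_expKernel (r : ℝ) :
    Continuous (fun q : EuclideanSpace ℝ (Fin n) ×
      (EuclideanSpace ℝ (Fin n) × EuclideanSpace ℝ (Fin n)) => expKernel σ r q.1 q.2) := by
  have hw := contDiff_posteriorWeight (n := n) (σ := σ).continuous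
  have h1 : Continuous (fun q : EuclideanSpace ℝ (Fin n) ×
      (EuclideanSpace ℝ (Fin n) × EuclideanSpace ℝ (Fin n)) => posteriorWeight σ q.1 q.2.1) :=
    hw.comp (continuous_fst.prodMk (continuous_fst.comp continuous_snd))
  have h2 : Continuous (fun q : EuclideanSpace ℝ (Fin n) ×
      (EuclideanSpace ℝ (Fin n) × EuclideanSpace ℝ (Fin n)) => posteriorWeight σ q.1 q.2.2) :=
    hw.comp (continuous_fst.prodMk (continuous_snd.comp continuous_snd))
  have h3 : Continuous (fun q : EuclideanSpace ℝ (Fin n) ×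
      (EuclideanSpace ℝ (Fin n) × EuclideanSpace ℝ (Fin n)) => (inner ℝ q.1 q.2.1 : ℝ)) :=
    continuous_fst.inner (continuous_fst.comp continuous_snd)
  exact (Real.continuous_exp.comp (continuous_const.mul h3.abs)).mul
    (h1.mul (h2.inv₀ fun _ => (posteriorWeight_pos _ _).ne'))

lemma expKernel_nonneg (r : ℝ) (y : EuclideanSpace ℝ (Fin n))
    (z : EuclideanSpace ℝ (Fin n) × EuclideanSpace ℝ (Fin n)) : 0 ≤ expKernel σ r y z :=
  mul_nonneg (Real.exp_pos _).le (mul_nonneg (posteriorWeight_pos _ _).le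
    (inv_nonneg.2 (posteriorWeight_pos _ _).le))

lemma posterior_exp_rpow_le (hQ : ∀ᵐ x ∂Q, x ∈ Metric.closedBall 0 R) {p : ℝ} (hp : 1 ≤ p)
    (r : ℝ) (y : EuclideanSpace ℝ (Fin n)) :
    ((∫ x, posteriorWeight σ y x ∂Q)⁻¹ *
      ∫ x, posteriorWeight σ y x * Real.exp (r * |inner ℝ y x|) ∂Q) ^ p ≤
      ∫ z, expKernel σ (r * p) y z ∂(Q.prod Q) := by
  have hwy := continuous_posteriorWeight (σ := σ) y
  have hexp : ∀ c : ℝ, Continuous (fun x : EuclideanSpace ℝ (Fin n) =>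
      Real.exp (c * |inner ℝ y x|)) := fun c =>
    Real.continuous_exp.comp (continuous_const.mul (continuous_const.inner continuous_id).abs)
  have hrp : ∀ x : EuclideanSpace ℝ (Fin n), Real.exp (r * |inner ℝ y x|) ^ p =
      Real.exp (r * p * |inner ℝ y x|) := fun x => by
    rw [← Real.exp_mul, mul_right_comm]
  have hJ := rpow_weighted_mean_le (Q := Q) (w := posteriorWeight σ y)
    (u := fun x => Real.exp (r * |inner ℝ y x|)) hp (posteriorWeight_pos y)
    (fun _ => Real.exp_pos _) (integrable_of_continuous_of_ae_mem_closedBall hQ hwy)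
    (integrable_of_continuous_of_ae_mem_closedBall hQ
      (hwy.inv₀ fun _ => (posteriorWeight_pos _ _).ne'))
    (integrable_of_continuous_of_ae_mem_closedBall hQ (hwy.mul (hexp _)))
    (by simp only [hrp]; exact integrable_of_continuous_of_ae_mem_closedBall hQ (hwy.mul (hexp _)))
  simp only [hrp] at hJ
  exact hJ

lemma lintegral_expKernel_le (hQ : ∀ᵐ x ∂Q, x ∈ Metric.closedBall 0 R) (hσ : 0 < σ)
    (hσR : σ ≤ R) {t : ℝ} (ht : R / σ ≤ t) {a : EuclideanSpace ℝ (Fin n)} (ha : ‖a‖ ≤ R) :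
    ∫⁻ g, ENNReal.ofReal (∫ z, expKernel σ (t / (σ * R)) (a + g) z ∂(Q.prod Q))
      ∂gaussianVar n σ ≤ ENNReal.ofReal (2 * Real.exp (8 * t ^ 2)) := by
  have hk := continuous_expKernel (n := n) (σ := σ) (t / (σ * R))
  have hof : ∀ y : EuclideanSpace ℝ (Fin n),
      ENNReal.ofReal (∫ z, expKernel σ (t / (σ * R)) y z ∂(Q.prod Q)) =
      ∫⁻ z, ENNReal.ofReal (expKernel σ (t / (σ * R)) y z) ∂(Q.prod Q) := fun y =>
    ofReal_integral_eq_lintegral_ofReal (integrable_of_continuous_of_ae_mem_compact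
      ((isCompact_closedBall _ _).prod (isCompact_closedBall _ _)) (ae_prod_mem_closedBall hQ)
      (hk.comp (continuous_const.prodMk continuous_id))) (.of_forall (expKernel_nonneg _ y))
  have hm : Measurable (Function.uncurry fun g z =>
      ENNReal.ofReal (expKernel (n := n) σ (t / (σ * R)) (a + g) z)) :=
    (ENNReal.continuous_ofReal.comp (hk.comp
      ((continuous_const.add continuous_fst).prodMk continuous_snd))).measurable
  simp only [hof]
  rw [lintegral_lintegral_swap hm.aemeasurable]
  calc _ ≤ ∫⁻ _, ENNReal.ofReal (2 * Real.exp (8 * t ^ 2)) ∂(Q.prod Q) := by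
        refine lintegral_mono_ae ?_
        filter_upwards [ae_prod_mem_closedBall hQ] with z hz
        exact lintegral_exp_abs_mul_posteriorWeight_le hσ hσR ht ha (by simpa using hz.1)
          (by simpa using hz.2)
    _ = _ := by rw [lintegral_const, measure_univ, mul_one]

lemma lintegral_norm_iterate_rpow_le (hQ : ∀ᵐ x ∂Q, x ∈ Metric.closedBall 0 R)
    (hσ : 0 < σ) (hσR : σ ≤ R) {m : ℕ} {p t : ℝ} (hp : 1 ≤ p) (ht : R / σ ≤ t)
    (hmp : m * p = t ^ 2) {a : EuclideanSpace ℝ (Fin n)} (ha : ‖a‖ ≤ R) :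
    ∫⁻ g, ‖(ouGenerator σ)^[m] (posteriorMean Q σ) (a + g)‖ₑ ^ p ∂gaussianVar n σ ≤
      ENNReal.ofReal (((30 * (m ^ 2 * (1 / σ ^ 2) ^ 2 * (t * σ * R))) ^ m * R * (2 * m + 1)) ^ p *
        (2 * Real.exp (8 * t ^ 2))) := by
  have hR : 0 < R := hσ.trans_le hσR
  have ht0 : 0 < t := (by positivity : 0 < R / σ).trans_le ht
  have hM : R ^ 2 ≤ t * σ * R := by
    rw [sq]
    exact mul_le_mul_of_nonneg_right ((div_le_iff₀ hσ).1 ht) hR.le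
  set B := (30 * (m ^ 2 * (1 / σ ^ 2) ^ 2 * (t * σ * R))) ^ m * R * (2 * m + 1) with hB
  have hB0 : 0 ≤ B := by positivity
  have hrate : m / (t * σ * R) * p = t / (σ * R) := by
    rw [div_mul_eq_mul_div, hmp]
    field_simp
  have hpt : ∀ y, ‖(ouGenerator σ)^[m] (posteriorMean Q σ) y‖ₑ ^ p ≤
      ENNReal.ofReal (B ^ p) *
        ENNReal.ofReal (∫ z, expKernel σ (t / (σ * R)) y z ∂(Q.prod Q)) := by
    intro y
    have hJ := posterior_exp_rpow_le (σ := σ) hQ hp (m / (t * σ * R)) y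
    have hN := norm_iterate_ouGenerator_posteriorMean_le hQ hσ hσR hM m y
    have hmean : 0 ≤ (∫ x, posteriorWeight σ y x ∂Q)⁻¹ *
        ∫ x, posteriorWeight σ y x * Real.exp (m / (t * σ * R) * |inner ℝ y x|) ∂Q :=
      mul_nonneg (inv_nonneg.2 (integral_posteriorWeight_pos hQ y).le)
        (integral_nonneg fun x => mul_nonneg (posteriorWeight_pos _ _).le (Real.exp_pos _).le)
    rw [hrate] at hJ
    rw [← ENNReal.ofReal_mul (by positivity), ← ofReal_norm,
      ENNReal.ofReal_rpow_of_nonneg (norm_nonneg _) (by linarith)]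
    refine ENNReal.ofReal_le_ofReal
      ((Real.rpow_le_rpow (norm_nonneg _) hN (by linarith)).trans ?_)
    rw [Real.mul_rpow hB0 hmean]
    exact mul_le_mul_of_nonneg_left hJ (by positivity)
  calc _ ≤ ∫⁻ g, ENNReal.ofReal (B ^ p) * ENNReal.ofReal
        (∫ z, expKernel σ (t / (σ * R)) (a + g) z ∂(Q.prod Q)) ∂gaussianVar n σ :=
        lintegral_mono fun g => hpt (a + g)
    _ = ENNReal.ofReal (B ^ p) * ∫⁻ g, ENNReal.ofReal
        (∫ z, expKernel σ (t / (σ * R)) (a + g) z ∂(Q.prod Q)) ∂gaussianVar n σ :=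
        lintegral_const_mul' _ _ ENNReal.ofReal_ne_top
    _ ≤ ENNReal.ofReal (B ^ p) * ENNReal.ofReal (2 * Real.exp (8 * t ^ 2)) := by
        gcongr
        exact lintegral_expKernel_le hQ hσ hσR ht ha
    _ = _ := by rw [← ENNReal.ofReal_mul (by positivity : 0 ≤ B ^ p)]

end Lp

/-! ### The norm estimates -/

section Conclusion

variable {n : ℕ} {σ R : ℝ} {Q : Measure (EuclideanSpace ℝ (Fin n))} [IsProbabilityMeasure Q]

instance isProbabilityMeasure_gaussianMixture : IsProbabilityMeasure (gaussianMixture Q σ) := by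
  unfold gaussianMixture
  infer_instance

lemma eLpNorm_le_of_lintegral_rpow_le {E F : Type} [MeasurableSpace E] [NormedAddCommGroup F]
    {ν : Measure E} {f : E → F} {B K p : ℝ} (hp : 1 ≤ p) (hB : 0 ≤ B)
    (h : ∫⁻ y, ‖f y‖ₑ ^ p ∂ν ≤ ENNReal.ofReal (B ^ p * (2 * Real.exp (K * p)))) :
    eLpNorm f (ENNReal.ofReal p) ν ≤ ENNReal.ofReal (B * (2 * Real.exp K)) := by
  have hp0 : 0 < p := by linarith
  rw [eLpNorm_eq_lintegral_rpow_enorm_toReal (by simpa using hp0) ENNReal.ofReal_ne_top,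
    ENNReal.toReal_ofReal hp0.le]
  have h2 : B ^ p * (2 * Real.exp (K * p)) ≤ (B * (2 * Real.exp K)) ^ p := by
    rw [Real.mul_rpow hB (by positivity), Real.mul_rpow two_pos.le (Real.exp_pos _).le,
      ← Real.exp_mul]
    gcongr
    exact Real.self_le_rpow_of_one_le one_le_two hp
  calc _ ≤ (ENNReal.ofReal ((B * (2 * Real.exp K)) ^ p)) ^ (1 / p) := by
        gcongr
        exact h.trans (ENNReal.ofReal_le_ofReal h2)
    _ = _ := by
        rw [← ENNReal.ofReal_rpow_of_nonneg (by positivity) hp0.le, ← ENNReal.rpow_mul,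
          mul_one_div_cancel hp0.ne', ENNReal.rpow_one]

/-- The common form of the two estimates. The `L^p` norm is bounded by the `L^{p'}` norm, where
`m p' = t ^ 2` for `t = max (R / σ) √(m p)`. The hypothesis on `ν` says that `ν` is dominated, on
nonnegative functions, by the supremum of the translates of `γ_{σ²}` by vectors of the ball. -/
lemma eLpNorm_iterate_le_of_lintegral (hQ : ∀ᵐ x ∂Q, x ∈ Metric.closedBall 0 R)
    (hσ : 0 < σ) (hσR : σ ≤ R) {ν : Measure (EuclideanSpace ℝ (Fin n))} [IsProbabilityMeasure ν]
    (hν : ∀ h : EuclideanSpace ℝ (Fin n) → ENNReal, Measurable h → ∀ c,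
      (∀ a, ‖a‖ ≤ R → ∫⁻ g, h (a + g) ∂gaussianVar n σ ≤ c) → ∫⁻ y, h y ∂ν ≤ c)
    (m : ℕ) {p : ℝ} (hp : 1 ≤ p) :
    eLpNorm ((ouGenerator σ)^[m] (posteriorMean Q σ)) (ENNReal.ofReal p) ν ≤
      ENNReal.ofReal (R * (180 * Real.exp 8 * ((1 / σ) ^ 2 * (m ^ 2 * R / σ) *
        max (R / σ) (Real.sqrt (m * p)))) ^ m) := by
  have hR : 0 < R := hσ.trans_le hσR
  rcases Nat.eq_zero_or_pos m with rfl | hm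
  · refine (eLpNorm_le_of_ae_bound (C := R) (.of_forall fun y => ?_)).trans (by simp)
    have h := norm_iterate_ouGenerator_posteriorMean_le hQ hσ hσR le_rfl 0 y
    -- for `m = 0` the pointwise bound is `‖f y‖ ≤ R`
    simpa [inv_mul_cancel₀ (integral_posteriorWeight_pos (σ := σ) hQ y).ne'] using h
  have hm0 : (0 : ℝ) < m := by exact_mod_cast hm
  have hp0 : 0 < p := by linarith
  set t := max (R / σ) (Real.sqrt (m * p)) with ht
  have htR : R / σ ≤ t := le_max_left _ _
  have ht0 : 0 < t := (by positivity : 0 < R / σ).trans_le htR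
  have htp : m * p ≤ t ^ 2 := by
    calc m * p = Real.sqrt (m * p) ^ 2 := (Real.sq_sqrt (by positivity)).symm
      _ ≤ t ^ 2 := by gcongr; exact le_max_right _ _
  set p' := t ^ 2 / m with hp'
  have hpp' : p ≤ p' := by rw [hp', le_div_iff₀ hm0]; linarith
  have hmp' : m * p' = t ^ 2 := by rw [hp']; field_simp
  have hsm := contDiff_iterate_ouGenerator_posteriorMean (Q := Q) hQ hσ hσR m
  set B := (30 * (m ^ 2 * (1 / σ ^ 2) ^ 2 * (t * σ * R))) ^ m * R * (2 * m + 1) with hB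
  have hB0 : 0 ≤ B := by positivity
  have h1 := hν (fun y => ‖(ouGenerator σ)^[m] (posteriorMean Q σ) y‖ₑ ^ p')
    (hsm.continuous.enorm.measurable.pow_const _) _ fun a ha =>
    lintegral_norm_iterate_rpow_le hQ hσ hσR (hp.trans hpp') htR hmp' ha
  rw [show 8 * t ^ 2 = 8 * m * p' by rw [← hmp', mul_assoc]] at h1
  have h2 := eLpNorm_le_of_lintegral_rpow_le (hp.trans hpp') hB0 h1
  refine (eLpNorm_le_eLpNorm_of_exponent_le (ENNReal.ofReal_le_ofReal hpp')
    hsm.continuous.aestronglyMeasurable).trans (h2.trans (ENNReal.ofReal_le_ofReal ?_))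
  -- the factors `2 m + 1`, `2` and `exp (8 m)` are absorbed into the `m`-th power
  have h3 : (2 * m + 1 : ℝ) ≤ 3 ^ m := by
    have := one_add_mul_le_pow (a := (2 : ℝ)) (by norm_num) m
    norm_num at this
    linarith
  have h4 : (2 : ℝ) ≤ 2 ^ m := by
    calc (2 : ℝ) = 2 ^ 1 := (pow_one _).symm
      _ ≤ 2 ^ m := pow_le_pow_right₀ one_le_two hm
  have h5 : Real.exp (8 * m) = Real.exp 8 ^ m := by rw [← Real.exp_nat_mul, mul_comm]
  calc B * (2 * Real.exp (8 * m))
      ≤ (30 * (m ^ 2 * (1 / σ ^ 2) ^ 2 * (t * σ * R))) ^ m * R * 3 ^ m *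
        (2 ^ m * Real.exp 8 ^ m) := by rw [hB, h5]; gcongr
    _ = R * (180 * Real.exp 8 * (m ^ 2 * (1 / σ ^ 2) ^ 2 * (t * σ * R))) ^ m := by
        rw [show (180 : ℝ) = 30 * 3 * 2 by norm_num]
        simp only [mul_pow]
        ring
    _ = _ := by
        congr 3
        field_simp

end Conclusion

theorem mainTheorem5 :
    ∃ C : ℝ, 0 < C ∧
      ∀ (n : ℕ) (Q₀ : Measure (EuclideanSpace ℝ (Fin n))) [IsProbabilityMeasure Q₀] (R σ : ℝ),
        0 < σ → σ ≤ R → Q₀ (Metric.closedBall 0 R) = 1 →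
          (∀ (m : ℕ) (p : ℝ), 1 ≤ p →
            eLpNorm ((ouGenerator σ)^[m] (posteriorMean Q₀ σ)) (ENNReal.ofReal p)
                (gaussianMixture Q₀ σ) ≤
              ENNReal.ofReal (R * (C * ((1 / σ) ^ 2 * (m * R / σ) ^ 2 *
                (1 + Real.sqrt (m * p) * σ / R))) ^ m)) ∧
          (∀ (m : ℕ) (p : ℝ), 1 ≤ p →
            eLpNorm ((ouGenerator σ)^[m] (posteriorMean Q₀ σ)) (ENNReal.ofReal p)
                (gaussianVar n σ) ≤
              ENNReal.ofReal (R * (C * ((1 / σ) ^ 2 * (m ^ 2 * R / σ) *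
                max (R / σ) (Real.sqrt (m * p)))) ^ m)) ∧
          IsGaussianNoiseSensitive (C * (R / σ)) σ (posteriorMean Q₀ σ) := by
  have hC1 : (1 : ℝ) ≤ 180 * Real.exp 8 := by
    have := Real.add_one_le_exp (8 : ℝ)
    linarith
  refine ⟨180 * Real.exp 8, by positivity, fun n Q₀ _ R σ hσ hσR hQ₀ => ?_⟩
  set C := 180 * Real.exp 8 with hC
  have hC0 : 0 < C := by positivity
  have hR : 0 < R := hσ.trans_le hσR
  have hQ : ∀ᵐ x ∂Q₀, x ∈ Metric.closedBall 0 R :=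
    (mem_ae_iff_prob_eq_one Metric.isClosed_closedBall.measurableSet).2 hQ₀
  have hγ : ∀ (m : ℕ) (p : ℝ), 1 ≤ p →
      eLpNorm ((ouGenerator σ)^[m] (posteriorMean Q₀ σ)) (ENNReal.ofReal p) (gaussianVar n σ) ≤
        ENNReal.ofReal (R * (C * ((1 / σ) ^ 2 * (m ^ 2 * R / σ) *
          max (R / σ) (Real.sqrt (m * p)))) ^ m) := fun m p hp =>
    eLpNorm_iterate_le_of_lintegral hQ hσ hσR
      (fun h _ c hc => by simpa using hc 0 (by simpa using hR.le)) m hp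
  refine ⟨fun m p hp => ?_, hγ, ?_, fun m p hp => (hγ m p hp).trans ?_⟩
  · refine (eLpNorm_iterate_le_of_lintegral hQ hσ hσR (fun h hh c hc => ?_) m hp).trans
      (ENNReal.ofReal_le_ofReal ?_)
    · rw [gaussianMixture, Measure.lintegral_conv hh]
      calc _ ≤ ∫⁻ _, c ∂Q₀ := by
            refine lintegral_mono_ae ?_
            filter_upwards [hQ] with a ha using hc a (by simpa using ha)
        _ = c := by simp
    · have hmax : max (R / σ) (Real.sqrt (m * p)) ≤ R / σ + Real.sqrt (m * p) :=
        max_le (le_add_of_nonneg_right (Real.sqrt_nonneg _))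
          (le_add_of_nonneg_left (by positivity))
      calc R * (C * ((1 / σ) ^ 2 * (m ^ 2 * R / σ) * max (R / σ) (Real.sqrt (m * p)))) ^ m
          ≤ R * (C * ((1 / σ) ^ 2 * (m ^ 2 * R / σ) * (R / σ + Real.sqrt (m * p)))) ^ m := by
            gcongr
        _ = _ := by
            congr 3
            field_simp
  · exact contDiff_iterate_ouGenerator_posteriorMean hQ hσ hσR 0
  · refine ENNReal.ofReal_le_ofReal ?_
    have h1 : max (R / σ) (Real.sqrt (m * p)) ≤ max (C * (R / σ)) (Real.sqrt (m * p)) :=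
      max_le_max_right _ (le_mul_of_one_le_left (by positivity) hC1)
    have h2 : R ≤ C * (R / σ) * σ := by
      rw [mul_assoc, div_mul_cancel₀ _ hσ.ne']
      exact le_mul_of_one_le_left hR.le hC1
    calc R * (C * ((1 / σ) ^ 2 * (m ^ 2 * R / σ) * max (R / σ) (Real.sqrt (m * p)))) ^ m
        ≤ C * (R / σ) * σ * (C * ((1 / σ) ^ 2 * (m ^ 2 * R / σ) *
          max (C * (R / σ)) (Real.sqrt (m * p)))) ^ m := by gcongr
      _ = _ := by
          rw [mul_assoc _ _ (max _ _ ^ m), ← mul_pow]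
          congr 2
          field_simp
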